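/- Let ${\cal A}$ be a von Neumann algebra (acting on a complex Hilbert space) with a finite, normal, faithful trace $\tau$. Let ${\cal A}_h$ be the real Banach space of selfadjoint elements of ${\cal A}$ with the operator norm, and let $G_{\cal A}$ be the group of invertible elements of ${\cal A}$. Let $H\subset{\cal A}_h$ be a norm closed real linear subspace which is supplemented, that is, there is a norm closed real subspace $S\subset{\cal A}_h$ with ${\cal A}_h=H\oplus S$ and $\tau(xs)=0$ for all $x\in H$, $s\in S$. Assume that $[x,[x,y]]\in H$ whenever $x,y\in H$, where $[x,y]=xy-yx$. Put $H^\perp=\{y\in{\cal A}_h:\tau(yx)=0\text{ for all }x\in H\}$. Then for every $g\in G_{\cal A}$ there is exactly one triple $(x,y,u)$ with $x\in H$, $y\in H^\perp$ and $u$ a unitary element of ${\cal A}$ such that \[ g=e^xe^yu . \] -/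

import Mathlib

universe u

section

variable {K : Type u} [NormedAddCommGroup K] [InnerProductSpace ℂ K] [CompleteSpace K]

open scoped ComplexOrder in
/-- `τ` is a finite, normal, faithful trace on the von Neumann algebra `A` acting on `K`.
The order on `A` is the Loewner order (`a ≤ b` iff `b - a` is a positive operator). -/
structure IsFiniteNormalFaithfulTrace (A : VonNeumannAlgebra K)
    (τ : A.toStarSubalgebra →ₗ[ℂ] ℂ) : Prop where
  /-- positivity -/
  nonneg : ∀ a, 0 ≤ τ (star a * a)
  /-- the trace property -/
  trace_comm : ∀ a b, τ (a * b) = τ (b * a)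
  /-- faithfulness -/
  faithful : ∀ a, τ (star a * a) = 0 → a = 0
  /-- normality: suprema of bounded upward directed families of positive elements are preserved -/
  normal : ∀ (D : Set A.toStarSubalgebra) (a : A.toStarSubalgebra), D.Nonempty →
    DirectedOn (· ≤ ·) D → (∀ d ∈ D, 0 ≤ d) → IsLUB D a → IsLUB (τ '' D) (τ a)

/-- For a real subspace `H` of the selfadjoint part of `A`, the orthogonal complement
`Hᗮ = {y ∈ A_h : τ(y x) = 0 for all x ∈ H}` inside the selfadjoint part of `A`. -/
noncomputable def tracialOrthogonal {A : VonNeumannAlgebra K} (τ : A.toStarSubalgebra →ₗ[ℂ] ℂ)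
    (H : Submodule ℝ A.toStarSubalgebra) : Submodule ℝ A.toStarSubalgebra where
  carrier := {y | IsSelfAdjoint y ∧ ∀ x ∈ H, τ (y * x) = 0}
  zero_mem' := ⟨IsSelfAdjoint.zero _, fun x _ => by simp⟩
  add_mem' := fun {a b} ha hb => ⟨ha.1.add hb.1, fun x hx => by
    rw [add_mul, map_add, ha.2 x hx, hb.2 x hx, add_zero]⟩
  smul_mem' := fun c a ha => ⟨(IsSelfAdjoint.all c).smul ha.1, fun x hx => by
    have h : (c • a) * x = (c : ℂ) • (a * x) := by
      rw [smul_mul_assoc]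
      rfl
    rw [h, map_smul, ha.2 x hx, smul_zero]⟩

/-- `H` is supplemented in the selfadjoint part `A_h`: there is a norm closed real subspace `S`
of `A_h`, orthogonal to `H` for the trace inner product, with `A_h = H ⊕ S`. -/
def IsTracialSupplemented {A : VonNeumannAlgebra K} (τ : A.toStarSubalgebra →ₗ[ℂ] ℂ)
    (H : Submodule ℝ A.toStarSubalgebra) : Prop :=
  ∃ S : Submodule ℝ A.toStarSubalgebra,
    IsClosed (S : Set A.toStarSubalgebra) ∧
    S ≤ tracialOrthogonal τ H ∧
    H ⊓ S = ⊥ ∧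
    H ⊔ S = selfAdjoint.submodule ℝ A.toStarSubalgebra

end

/-! Modulo unitaries on the right, an invertible g is the positive element g g*. The distance from
e^x to g is the trace norm of `polarLog (exp (-x) * g)`, and this geometry has nonpositive
curvature. The source of the curvature bound is N(z) ≤ N(cosh(ad q) z) for selfadjoint q and z,
valid for the operator norm and for the trace norm (`norm_le_norm_coshConj`,
`IsFaithfulTrace.seminorm_le_coshConj`). Repeated halving of q turns it into an expansion bound for
the differential of exp (`IsConjExpansive.le_symDexp`), which integrates to the metric increasing
property (`IsConjExpansive.polarLog_mul_sub_le`).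

The double bracket condition makes the exponentials of H a convex set: the logarithm of e^x e^{2v}
e^x stays in H (`IsTripleSplitting.polarLog_exp_mul_exp_mem`).

The factor e^x is the foot of the perpendicular from g to this convex set. Midpoints
(`IsTripleSplitting.exists_midpoint`) make minimising sequences in an operator norm ball of H Cauchy
for the trace norm, and such balls are complete by a noncommutative Egorov argument
(`IsFiniteNormalFaithfulTrace.isBallComplete`). If the ball is large, a minimiser is critical even
on the boundary (`IsTripleSplitting.map_polarLog_eq_zero_of_minimiser`). Criticality says that
`polarLog (exp (-x) * g)` is orthogonal to H; half of it is y, and polar decomposition supplies u.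
Uniqueness follows from a Pythagorean inequality at the foot
(`IsTripleSplitting.seminorm_sq_add_le`). -/

/-! ### The differential of exp and the expansion property of seminorms. -/

section ExpCalculus

open NormedSpace Filter Topology

variable {B : Type*} [CStarAlgebra B]

lemma exp_add_of_commute_real {R : Type*} [NormedRing R] [NormedAlgebra ℝ R] [CompleteSpace R]
    {x y : R} (h : Commute x y) : exp (x + y) = exp x * exp y :=
  let : NormedAlgebra ℚ R := NormedAlgebra.restrictScalars ℚ ℝ R
  exp_add_of_commute h

lemma exp_neg_mul_exp (q : B) : exp (-q) * exp q = 1 := by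
  have h := exp_add_of_commute_real (Commute.neg_left (Commute.refl q))
  rw [neg_add_cancel, exp_zero] at h
  exact h.symm

lemma exp_mul_exp_neg (q : B) : exp q * exp (-q) = 1 := by
  simpa using exp_neg_mul_exp (-q)

lemma exp_smul_mul_exp_smul (s t : ℝ) (q : B) :
    exp (s • q) * exp (t • q) = exp ((s + t) • q) := by
  rw [add_smul, exp_add_of_commute_real]
  exact ((Commute.refl q).smul_left s).smul_right t

lemma exp_half_mul_exp_half (q : B) : exp ((1 / 2 : ℝ) • q) * exp ((1 / 2 : ℝ) • q) = exp q := by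
  rw [exp_smul_mul_exp_smul]; norm_num

lemma norm_exp_le_exp_norm_of_isSelfAdjoint {q : B} (hq : IsSelfAdjoint q) :
    ‖exp q‖ ≤ Real.exp ‖q‖ := by
  rw [← CFC.real_exp_eq_normedSpace_exp hq]
  refine norm_cfc_le (Real.exp_nonneg _) fun x hx => ?_
  rw [Real.norm_eq_abs, Real.abs_exp]
  refine Real.exp_le_exp.mpr ((le_abs_self x).trans ?_)
  have : Nontrivial B := by
    by_contra h
    rw [not_nontrivial_iff_subsingleton] at h
    simp at hx
  exact spectrum.norm_le_norm_of_mem hx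

/-- The derivative of the exponential map at `q`. -/
noncomputable def dexp (q : B) : B →L[ℝ] B := fderiv ℝ exp q

lemma contDiff_exp : ContDiff ℝ 2 (exp : B → B) :=
  contDiff_iff_contDiffAt.mpr fun q => (exp_analytic (𝕂 := ℝ) q).contDiffAt

lemma hasFDerivAt_exp_dexp (q : B) : HasFDerivAt exp (dexp q) q :=
  (contDiff_exp.differentiable (by norm_num) q).hasFDerivAt

lemma contDiff_dexp : ContDiff ℝ 1 (dexp : B → B →L[ℝ] B) :=
  contDiff_exp.fderiv_right (by norm_num)

lemma dexp_zero : dexp (0 : B) = 1 := (hasFDerivAt_exp_zero (𝕂 := ℝ)).fderiv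

lemma star_dexp (q z : B) : star (dexp q z) = dexp (star q) (star z) := by
  let S : B →L[ℝ] B := (starL' ℝ : B ≃L[ℝ] B)
  have h1 : HasFDerivAt (fun x : B => S (exp x)) (S.comp (dexp q)) q :=
    S.hasFDerivAt.comp q (hasFDerivAt_exp_dexp q)
  have h2 : HasFDerivAt (fun x : B => exp (S x)) ((dexp (star q)).comp S) q :=
    HasFDerivAt.comp q (hasFDerivAt_exp_dexp (star q)) S.hasFDerivAt
  have h3 : (fun x : B => S (exp x)) = fun x => exp (S x) := by
    funext x; exact star_exp x
  rw [h3] at h1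
  exact DFunLike.congr_fun (h1.unique h2) z

/-- The product rule applied to exp q = exp(q/2)². -/
lemma dexp_eq_half (q z : B) :
    dexp q z = (1 / 2 : ℝ) • (dexp ((1 / 2 : ℝ) • q) z * exp ((1 / 2 : ℝ) • q)
      + exp ((1 / 2 : ℝ) • q) * dexp ((1 / 2 : ℝ) • q) z) := by
  let M : B →L[ℝ] B := (1 / 2 : ℝ) • ContinuousLinearMap.id ℝ B
  have h1 : HasFDerivAt (fun x : B => exp (M x)) ((dexp (M q)).comp M) q :=
    HasFDerivAt.comp q (hasFDerivAt_exp_dexp (M q)) M.hasFDerivAt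
  have h2 := h1.mul' h1
  have h3 : (fun x : B => exp (M x)) * (fun x : B => exp (M x)) = exp := by
    funext x; exact exp_half_mul_exp_half x
  rw [h3] at h2
  have h4 := DFunLike.congr_fun ((hasFDerivAt_exp_dexp q).unique h2) z
  rw [h4]
  simp [M, smul_add, add_comm]

/-- The hyperbolic cosine of `ad q` applied to `z`. -/
noncomputable def coshConj (q z : B) : B :=
  (1 / 2 : ℝ) • (exp q * z * exp (-q) + exp (-q) * z * exp q)

/-- The derivative of the exponential map at `q`, transported to the identity. -/
noncomputable def symDexp (q z : B) : B :=
  exp (-((1 / 2 : ℝ) • q)) * dexp q z * exp (-((1 / 2 : ℝ) • q))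

/-- Formally `symDexp q` is sinh(s)/s at s = ad q / 2, and this is the duplication formula sinh(s)/s
= cosh(s/2) · sinh(s/2)/(s/2). Deriving it from `dexp_eq_half` avoids any power series in ad q. -/
lemma symDexp_eq_coshConj (q z : B) :
    symDexp q z = coshConj ((1 / 4 : ℝ) • q) (symDexp ((1 / 2 : ℝ) • q) z) := by
  have e1 : exp (-((1 / 2 : ℝ) • q)) = exp (-((1 / 4 : ℝ) • q)) * exp (-((1 / 4 : ℝ) • q)) := by
    rw [← neg_smul, ← neg_smul, exp_smul_mul_exp_smul]; norm_num
  have e2 : exp ((1 / 2 : ℝ) • q) = exp ((1 / 4 : ℝ) • q) * exp ((1 / 4 : ℝ) • q) := by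
    rw [exp_smul_mul_exp_smul]; norm_num
  have h1 := exp_neg_mul_exp ((1 / 4 : ℝ) • q)
  have h2 := exp_mul_exp_neg ((1 / 4 : ℝ) • q)
  have e3 : ((1 / 2 : ℝ) • (1 / 2 : ℝ) • q) = (1 / 4 : ℝ) • q := by rw [smul_smul]; norm_num
  unfold symDexp coshConj
  rw [dexp_eq_half, e3, e1, e2]
  set a := exp ((1 / 4 : ℝ) • q)
  set b := exp (-((1 / 4 : ℝ) • q))
  set D := dexp ((1 / 2 : ℝ) • q) z
  rw [mul_smul_comm, smul_mul_assoc]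
  congr 1
  have ab (x : B) : a * (b * x) = x := by rw [← mul_assoc, h2, one_mul]
  have ba (x : B) : b * (a * x) = x := by rw [← mul_assoc, h1, one_mul]
  have k1 : b * b * (D * (a * a)) * (b * b) = b * (b * D * b) * a := by
    simp only [mul_assoc, ab, h1, h2, mul_one]
  have k2 : b * b * ((a * a) * D) * (b * b) = a * (b * D * b) * b := by
    simp only [mul_assoc, ab, ba]
  rw [mul_add, add_mul, k1, k2, add_comm]

lemma symDexp_zero (z : B) : symDexp 0 z = z := by
  simp [symDexp, dexp_zero]

lemma continuous_symDexp (z : B) : Continuous fun q : B => symDexp q z := by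
  have h := contDiff_dexp (B := B).continuous
  have e : Continuous (exp : B → B) := contDiff_exp.continuous
  unfold symDexp
  fun_prop

lemma isSelfAdjoint_symDexp {q z : B} (hq : IsSelfAdjoint q) (hz : IsSelfAdjoint z) :
    IsSelfAdjoint (symDexp q z) := by
  have h : IsSelfAdjoint (exp (-((1 / 2 : ℝ) • q))) :=
    ((IsSelfAdjoint.all (1 / 2 : ℝ)).smul hq).neg.exp
  have hd : IsSelfAdjoint (dexp q z) := by
    rw [IsSelfAdjoint, star_dexp, hq.star_eq, hz.star_eq]
  have := hd.conjugate (exp (-((1 / 2 : ℝ) • q)))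
  rwa [h.star_eq] at this

lemma tendsto_symDexp_pow (q z : B) :
    Tendsto (fun n : ℕ => symDexp (((1 / 2 : ℝ) ^ n) • q) z) atTop (𝓝 z) := by
  have h1 : Tendsto (fun n : ℕ => ((1 / 2 : ℝ) ^ n) • q) atTop (𝓝 ((0 : ℝ) • q)) :=
    (tendsto_pow_atTop_nhds_zero_of_lt_one (by norm_num) (by norm_num)).smul_const q
  have h2 := ((continuous_symDexp z).tendsto ((0 : ℝ) • q)).comp h1
  rw [zero_smul, symDexp_zero] at h2
  exact h2

/-- A seminorm that is continuous, unitarily invariant and satisfies the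
Corach-Porta-Recht inequality. -/
structure IsConjExpansive (N : Seminorm ℝ B) : Prop where
  continuous : Continuous N
  unitary_conj : ∀ u ∈ unitary B, ∀ z, N (u * z * star u) = N z
  le_coshConj : ∀ q z, IsSelfAdjoint q → IsSelfAdjoint z → N z ≤ N (coshConj q z)

/-- Each halving of q strips off one cosh factor, which can only have increased N; in the limit q →
0 only z is left. -/
lemma IsConjExpansive.le_symDexp {N : Seminorm ℝ B} (hN : IsConjExpansive N) {q z : B}
    (hq : IsSelfAdjoint q) (hz : IsSelfAdjoint z) : N z ≤ N (symDexp q z) := by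
  have hs (c : ℝ) : IsSelfAdjoint (c • q) := (IsSelfAdjoint.all c).smul hq
  have key : ∀ n : ℕ, N (symDexp (((1 / 2 : ℝ) ^ n) • q) z) ≤ N (symDexp q z) := by
    intro n
    induction n with
    | zero => simp
    | succ n ih =>
      refine le_trans ?_ ih
      rw [symDexp_eq_coshConj (((1 / 2 : ℝ) ^ n) • q), smul_smul, smul_smul, pow_succ', ]
      exact hN.le_coshConj _ _ (hs _) (isSelfAdjoint_symDexp (hs _) hz)
  exact le_of_tendsto ((hN.continuous.tendsto z).comp (tendsto_symDexp_pow q z))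
    (Eventually.of_forall key)

/-- The mean value inequality for a seminorm other than the norm that defines the derivative: the
right slopes of N(f t - f 0) are bounded by N of the slopes of f. -/
lemma Seminorm.map_sub_le_of_hasDerivAt (N : Seminorm ℝ B) (hN : Continuous N) {f f' : ℝ → B}
    {C : ℝ} (hf : ∀ t, HasDerivAt f (f' t) t) (hC : ∀ t ∈ Set.Icc (0 : ℝ) 1, N (f' t) ≤ C) :
    N (f 1 - f 0) ≤ C := by
  have hfc : Continuous f := continuous_iff_continuousAt.mpr fun t => (hf t).continuousAt
  have := image_le_of_liminf_slope_right_le_deriv_boundary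
    (f := fun t => N (f t - f 0)) (a := 0) (b := 1) (B := fun t => C * t) (B' := fun _ => C)
    (by fun_prop) (by simp) (by fun_prop)
    (fun x _ => by simpa using ((hasDerivAt_id x).const_mul C).hasDerivWithinAt)
    (fun x hx r hr => by
      apply Eventually.frequently
      have h1 : Tendsto (fun z => N (slope f x z)) (𝓝[>] x) (𝓝 (N (f' x))) :=
        (hN.tendsto _).comp ((hasDerivAt_iff_tendsto_slope.mp (hf x)).mono_left
          (nhdsWithin_mono _ fun y (hy : x < y) => hy.ne'))
      have h2 := h1.eventually_lt_const ((hC x ⟨hx.1, hx.2.le⟩).trans_lt hr)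
      filter_upwards [h2, self_mem_nhdsWithin] with z hz hxz
      refine lt_of_le_of_lt ?_ hz
      have hpos : 0 < z - x := sub_pos.mpr hxz
      rw [slope_def_field, slope_def_module, map_smul_eq_mul, Real.norm_of_nonneg (by positivity),
        div_eq_inv_mul]
      refine mul_le_mul_of_nonneg_left ?_ (by positivity)
      have := map_sub_le_add N (f z - f 0) (f x - f 0)
      have h3 : N (f z - f 0) ≤ N (f z - f x) + N (f x - f 0) := by
        simpa using map_add_le_add N (f z - f x) (f x - f 0)
      linarith)
  simpa using this (x := 1) (by simp)

end ExpCalculus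

/-! ### The operator norm is expansive; polar decomposition and smooth logarithms. -/

section NormExpansive

open NormedSpace Filter Topology

variable {B : Type*} [CStarAlgebra B]

/-- Y is 1/2 plus a skew part, so 4YY* = 1 + (Y - Y*)*(Y - Y*) ≥ 1; moreover Y commutes with Y* = 1
- Y, so invertibility of the product passes to Y. -/
lemma isUnit_of_add_star_eq_one {Y : B} (h : Y + star Y = 1) : IsUnit Y := by
  let := CStarAlgebra.spectralOrder B
  let := CStarAlgebra.spectralOrderedRing B
  have hs : star Y = 1 - Y := by rw [← h]; abel
  have h1 : (4 : ℝ) • (Y * star Y) = 1 + star (Y - star Y) * (Y - star Y) := by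
    have e : (4 : ℝ) • (Y * star Y) = (4 : ℕ) • (Y * star Y) := by
      rw [← Nat.cast_smul_eq_nsmul ℝ]; norm_num
    rw [e, star_sub, star_star, hs]
    noncomm_ring
  have h2 : IsUnit ((4 : ℝ) • (Y * star Y)) := by
    rw [h1]
    refine CStarAlgebra.isUnit_of_le (1 : B) ?_
    simpa using star_mul_self_nonneg (Y - star Y)
  have h3 : IsUnit (Y * star Y) := by
    have := (isUnit_smul_iff (Units.mk0 (4 : ℝ) (by norm_num)) (Y * star Y)).mp h2
    exact this
  have hc : Commute Y (star Y) := by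
    rw [hs]; exact (Commute.one_right Y).sub_right (Commute.refl Y)
  exact (hc.isUnit_mul_iff.mp h3).1

/-- Conjugating by the inverse square root of X + X* normalises this sum to 1. -/
lemma isUnit_of_isStrictlyPositive_add_star [PartialOrder B] [StarOrderedRing B] {X : B}
    (h : IsStrictlyPositive (X + star X)) : IsUnit X := by
  set c := X + star X with hc
  have hs : IsUnit (CFC.sqrt c) := CFC.isUnit_sqrt_iff_isStrictlyPositive.mpr h
  have hsa : IsSelfAdjoint (CFC.sqrt c) := (CFC.sqrt_nonneg c).isSelfAdjoint
  have hsq : CFC.sqrt c * CFC.sqrt c = c := CFC.sqrt_mul_sqrt_self c h.nonneg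
  obtain ⟨s, hs'⟩ := hs
  rw [← hs'] at hsa hsq
  have hinv : star (↑s⁻¹ : B) = ↑s⁻¹ := by
    have : star s = s := Units.ext hsa
    rw [← Units.coe_star, star_inv, this]
  have hY : (↑s⁻¹ * X * ↑s⁻¹ : B) + star (↑s⁻¹ * X * ↑s⁻¹ : B) = 1 := by
    rw [star_mul, star_mul, hinv]
    calc (↑s⁻¹ * X * ↑s⁻¹ : B) + ↑s⁻¹ * (star X * ↑s⁻¹) = ↑s⁻¹ * (X + star X) * ↑s⁻¹ := by
          noncomm_ring
      _ = 1 := by rw [← hc, ← hsq]; simp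
  have := isUnit_of_add_star_eq_one hY
  rwa [Units.isUnit_mul_units, Units.isUnit_units_mul] at this

/-- If r exceeds the norm of the real part of T, then r - T has strictly positive real part and is
invertible. Negative r are handled by passing to -T. -/
lemma abs_le_norm_of_mem_spectrum {T : B} {r : ℝ} (hr : r ∈ spectrum ℝ T) :
    |r| ≤ ‖(1 / 2 : ℝ) • (T + star T)‖ := by
  let := CStarAlgebra.spectralOrder B
  let := CStarAlgebra.spectralOrderedRing B
  have key : ∀ (T : B) (r : ℝ), r ∈ spectrum ℝ T → r ≤ ‖(1 / 2 : ℝ) • (T + star T)‖ := by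
    intro T r hr
    by_contra! hlt
    set a := (1 / 2 : ℝ) • (T + star T) with ha
    have hsa : IsSelfAdjoint a := (IsSelfAdjoint.all (1 / 2 : ℝ)).smul (.add_star_self T)
    have hpos : IsStrictlyPositive (algebraMap ℝ B r - a) := by
      refine IsStrictlyPositive.of_le
        (isStrictlyPositive_algebraMap (A := B) (sub_pos.mpr hlt)) ?_
      rw [map_sub]
      exact sub_le_sub_left hsa.le_algebraMap_norm_self _
    refine hr (isUnit_of_isStrictlyPositive_add_star ?_)
    have e : (algebraMap ℝ B r - T) + star (algebraMap ℝ B r - T)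
        = (2 : ℝ) • (algebraMap ℝ B r - a) := by
      rw [star_sub, ha, (IsSelfAdjoint.algebraMap B (.all r)).star_eq, smul_sub, smul_smul,
        two_smul]
      norm_num
      abel
    rw [e]
    exact hpos.smul (by norm_num)
  rcases abs_cases r with ⟨h, _⟩ | ⟨h, _⟩
  · rw [h]; exact key T r hr
  · rw [h]
    have h1 := key (-T) (-r) (by
      rw [← spectrum.neg_eq]; simpa using hr)
    refine h1.trans_eq ?_
    rw [star_neg, ← neg_add, smul_neg, norm_neg]

/-- cosh(ad q) z is the real part of e^q z e^{-q}, which is similar to z. So ‖z‖ or -‖z‖ lies in the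
spectrum of the conjugate and is bounded by the norm of its real part. -/
lemma norm_le_norm_coshConj {q z : B} (hq : IsSelfAdjoint q) (hz : IsSelfAdjoint z) :
    ‖z‖ ≤ ‖coshConj q z‖ := by
  let := CStarAlgebra.spectralOrder B
  let := CStarAlgebra.spectralOrderedRing B
  rcases subsingleton_or_nontrivial B with h | h
  · rw [Subsingleton.elim (coshConj q z) z]
  let u : Bˣ := ⟨exp q, exp (-q), exp_mul_exp_neg q, exp_neg_mul_exp q⟩
  have hstar : star (exp q * z * exp (-q)) = exp (-q) * z * exp q := by
    rw [star_mul, star_mul, hz.star_eq, hq.exp.star_eq, hq.neg.exp.star_eq, mul_assoc]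
  have key : ∀ r ∈ spectrum ℝ z, |r| ≤ ‖coshConj q z‖ := by
    intro r hr
    have h1 : r ∈ spectrum ℝ (exp q * z * exp (-q)) := by
      have := spectrum.units_conjugate (R := ℝ) (a := z) (u := u)
      rw [← this] at hr
      exact hr
    have h2 := abs_le_norm_of_mem_spectrum h1
    rwa [hstar] at h2
  rcases CStarAlgebra.norm_or_neg_norm_mem_spectrum hz with h | h
  · simpa using key _ h
  · simpa using key _ h

lemma isConjExpansive_norm : IsConjExpansive (normSeminorm ℝ B) where
  continuous := continuous_norm
  unitary_conj u hu z := by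
    have : ‖u * z * star u‖ = ‖z‖ := by
      rw [CStarRing.norm_mul_mem_unitary _ (Unitary.star_mem hu),
        CStarRing.norm_mem_unitary_mul _ hu]
    exact this
  le_coshConj _ _ hq hz := norm_le_norm_coshConj hq hz

/-- The logarithm of `g * star g`. -/
noncomputable def polarLog (g : B) : B := CFC.log (g * star g)

lemma isSelfAdjoint_polarLog (g : B) : IsSelfAdjoint (polarLog g) := IsSelfAdjoint.log

lemma isUnit_exp' (q : B) : IsUnit (exp q) :=
  ⟨⟨exp q, exp (-q), exp_mul_exp_neg q, exp_neg_mul_exp q⟩, rfl⟩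

lemma exp_polarLog {g : B} (hg : IsUnit g) : exp (polarLog g) = g * star g := by
  let := CStarAlgebra.spectralOrder B
  let := CStarAlgebra.spectralOrderedRing B
  exact CFC.exp_log _ ((hg.mul hg.star).isStrictlyPositive (mul_star_self_nonneg g))

lemma exp_injOn_isSelfAdjoint {p q : B} (hp : IsSelfAdjoint p) (hq : IsSelfAdjoint q)
    (h : exp p = exp q) : p = q := by
  rw [← CFC.log_exp p hp, h, CFC.log_exp q hq]

lemma polarLog_eq_of_exp_eq {g p : B} (hp : IsSelfAdjoint p) (h : exp p = g * star g) :
    polarLog g = p := by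
  rw [polarLog, ← h, CFC.log_exp p hp]

lemma polarLog_exp {p : B} (hp : IsSelfAdjoint p) : polarLog (exp p) = (2 : ℝ) • p := by
  refine polarLog_eq_of_exp_eq ((IsSelfAdjoint.all (2 : ℝ)).smul hp) ?_
  rw [hp.exp.star_eq, two_smul, exp_add_of_commute_real (Commute.refl p)]

lemma polarLog_mul_unitary (g : B) {u : B} (hu : u ∈ unitary B) :
    polarLog (g * u) = polarLog g := by
  rw [polarLog, polarLog, star_mul, mul_assoc, ← mul_assoc u, Unitary.mul_star_self_of_mem hu,
    one_mul]

lemma exp_unitary_conj {u : B} (hu : u ∈ unitary B) (q : B) :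
    exp (u * q * star u) = u * exp q * star u := by
  let : NormedAlgebra ℚ B := NormedAlgebra.restrictScalars ℚ ℝ B
  exact exp_units_conj (Unitary.toUnits ⟨u, hu⟩) q

lemma polarLog_unitary_mul {g : B} (hg : IsUnit g) {u : B} (hu : u ∈ unitary B) :
    polarLog (u * g) = u * polarLog g * star u := by
  refine polarLog_eq_of_exp_eq ((isSelfAdjoint_polarLog g).conjugate u) ?_
  rw [exp_unitary_conj hu, exp_polarLog hg, star_mul]
  simp only [mul_assoc]

/-- Left polar decomposition: with e^{2p} = g g*, the element e^{-p} g satisfies u u* = 1 and is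
invertible, hence unitary. -/
lemma exists_eq_exp_mul_unitary {g : B} (hg : IsUnit g) :
    ∃ u ∈ unitary B, g = exp ((1 / 2 : ℝ) • polarLog g) * u := by
  set p := (1 / 2 : ℝ) • polarLog g with hp
  have hsa : IsSelfAdjoint p := (IsSelfAdjoint.all (1 / 2 : ℝ)).smul (isSelfAdjoint_polarLog g)
  have hpp : exp p * exp p = g * star g := by
    rw [hp, exp_half_mul_exp_half, exp_polarLog hg]
  have h1 : (exp (-p) * g) * star (exp (-p) * g) = 1 := by
    rw [star_mul, hsa.neg.exp.star_eq]
    calc exp (-p) * g * (star g * exp (-p)) = exp (-p) * (g * star g) * exp (-p) := by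
          noncomm_ring
      _ = (exp (-p) * exp p) * (exp p * exp (-p)) := by rw [← hpp]; noncomm_ring
      _ = 1 := by rw [exp_neg_mul_exp, exp_mul_exp_neg, one_mul]
  have hu : IsUnit (exp (-p) * g) := (isUnit_exp' _).mul hg
  refine ⟨exp (-p) * g, Unitary.mem_iff.mpr ⟨?_, h1⟩, ?_⟩
  · obtain ⟨w, hw⟩ := hu
    rw [← hw] at h1 ⊢
    have : star (w : B) = ↑w⁻¹ := (Units.inv_eq_of_mul_eq_one_right h1).symm
    rw [this, Units.inv_mul]
  · rw [← mul_assoc, exp_mul_exp_neg, one_mul]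

lemma IsConjExpansive.polarLog_unitary_mul {N : Seminorm ℝ B} (hN : IsConjExpansive N) {g : B}
    (hg : IsUnit g) {u : B} (hu : u ∈ unitary B) : N (polarLog (u * g)) = N (polarLog g) := by
  rw [_root_.polarLog_unitary_mul hg hu, hN.unitary_conj u hu]

lemma continuous_polarLog {X : Type*} [TopologicalSpace X] {g : X → B} (hg : Continuous g)
    (hu : ∀ x, IsUnit (g x)) : Continuous fun x => polarLog (g x) := by
  rw [← continuousOn_univ]
  exact CFC.continuousOn_log.comp (by fun_prop)
    fun x _ => ⟨.mul_star_self _, (hu x).mul (hu x).star⟩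

lemma norm_le_norm_symDexp {q z : B} (hq : IsSelfAdjoint q) (hz : IsSelfAdjoint z) :
    ‖z‖ ≤ ‖symDexp q z‖ :=
  isConjExpansive_norm.le_symDexp hq hz

/-- A continuous logarithm of a differentiable curve is differentiable. -/
lemma exists_hasDerivAt_of_exp {q : ℝ → B} {γ' : B} {t : ℝ} (hsa : ∀ s, IsSelfAdjoint (q s))
    (hc : ContinuousAt q t) (hd : HasDerivAt (fun s => exp (q s)) γ' t) :
    ∃ z, IsSelfAdjoint z ∧ HasDerivAt q z t ∧ dexp (q t) z = γ' := by
  -- The lower bound for the differential of exp holds only in selfadjoint directions, so the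
  -- argument lives on this closed subspace.
  let V := selfAdjoint.submodule ℝ B
  have hV : IsClosed (V : Set B) := isClosed_eq continuous_star continuous_id
  have : CompleteSpace V := hV.completeSpace_coe
  let L : V →L[ℝ] B := (dexp (q t)).comp V.subtypeL
  obtain ⟨C, hC0, hC⟩ : ∃ C : NNReal, 0 < C ∧ ∀ z : V, ‖z‖ ≤ C * ‖L z‖ := by
    -- The two factors come from unfolding `symDexp`; the summand 1 only makes the constant
    -- positive.
    refine ⟨‖exp (-((1 / 2 : ℝ) • q t))‖₊ * ‖exp (-((1 / 2 : ℝ) • q t))‖₊ + 1, by positivity,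
      fun z => ?_⟩
    have h1 : ‖(z : B)‖ ≤ ‖symDexp (q t) z‖ := norm_le_norm_symDexp (hsa t) z.2
    have h2 : ‖symDexp (q t) (z : B)‖
        ≤ ‖exp (-((1 / 2 : ℝ) • q t))‖ * ‖L z‖ * ‖exp (-((1 / 2 : ℝ) • q t))‖ :=
      (norm_mul_le _ _).trans (mul_le_mul_of_nonneg_right (norm_mul_le _ _) (norm_nonneg _))
    have h3 := h1.trans h2
    have h4 : ‖z‖ = ‖(z : B)‖ := rfl
    push_cast
    rw [h4]
    nlinarith [norm_nonneg (L z)]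
  have hanti : AntilipschitzWith C L := by
    refine ContinuousLinearMap.antilipschitz_of_bound L hC
  let f : ℝ → V := fun s => ⟨q s, hsa s⟩
  have hlin : (fun s => exp (q s) - exp (q t) - L (f s - f t)) =o[𝓝 t] fun s => f s - f t := by
    have := (hasFDerivAt_exp_dexp (q t)).isLittleO.comp_tendsto hc
    have h := Asymptotics.isLittleO_norm_right.mpr this
    exact Asymptotics.isLittleO_norm_right.mp h
  have hbig : (fun s => f s - f t) =O[𝓝 t] fun s => L (f s - f t) :=
    Asymptotics.IsBigO.of_bound C (Eventually.of_forall fun s => hC _)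
  have hd' := hd.isLittleO
  have hO : (fun s => exp (q s) - exp (q t)) =O[𝓝 t] fun s => s - t :=
    hd.hasFDerivAt.isBigO_sub
  have h1 : (fun s => L (f s - f t)) =O[𝓝 t] fun s => exp (q s) - exp (q t) :=
    ((hlin.trans_isBigO hbig).right_isBigO_add.congr_left (fun s => rfl)).congr_right
      (fun s => by simp)
  have h2 : (fun s => exp (q s) - exp (q t) - L (f s - f t)) =o[𝓝 t] fun s => s - t :=
    hlin.trans_isBigO (hbig.trans (h1.trans hO))
  have h3 : HasDerivAt (fun s => L (f s)) γ' t := by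
    rw [hasDerivAt_iff_isLittleO]
    have := hd.isLittleO.sub h2
    refine this.congr_left fun s => ?_
    simp only [map_sub]
    abel
  -- A map bounded below has closed range, so γ', a limit of values of L, is itself a value;
  -- surjectivity of L is not needed.
  have hemb := hanti.isClosedEmbedding L.uniformContinuous
  have h4 : Tendsto (fun s => L (slope f t s)) (𝓝[≠] t) (𝓝 γ') := by
    have := hasDerivAt_iff_tendsto_slope.mp h3
    refine this.congr fun s => ?_
    simp [slope_def_module]
  obtain ⟨z, hz⟩ : γ' ∈ Set.range L :=
    hemb.isClosed_range.mem_of_tendsto h4 (Eventually.of_forall fun s => Set.mem_range_self _)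
  rw [← hz] at h4
  have h5 : Tendsto (slope f t) (𝓝[≠] t) (𝓝 z) := hemb.isEmbedding.tendsto_nhds_iff.mpr h4
  have h6 : HasDerivAt f z t := hasDerivAt_iff_tendsto_slope.mpr h5
  exact ⟨z, z.2, V.subtypeL.hasFDerivAt.comp_hasDerivAt t h6, hz⟩

end NormExpansive

/-! ### The exponential metric increasing property. -/

section MetricIncreasing

open NormedSpace Filter Topology

variable {B : Type*} [CStarAlgebra B]

lemma exists_hasDerivAt_polarLog {g : ℝ → B} {g' : B} {t : ℝ} (hc : Continuous g)
    (hu : ∀ s, IsUnit (g s)) (hd : HasDerivAt g g' t) :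
    ∃ z, IsSelfAdjoint z ∧ HasDerivAt (fun s => polarLog (g s)) z t ∧
      dexp (polarLog (g t)) z = g' * star (g t) + g t * star g' := by
  refine exists_hasDerivAt_of_exp (fun s => isSelfAdjoint_polarLog _)
    (continuous_polarLog hc hu).continuousAt ?_
  have : (fun s => exp (polarLog (g s))) = fun s => g s * star (g s) :=
    funext fun s => exp_polarLog (hu s)
  rw [this]
  exact hd.mul hd.star

/-- Along t ↦ e^p e^{tv}, the transported velocity of the logarithm is a unitary conjugate of 2v.
Its N-length is therefore constant, and `le_symDexp` says that the logarithm itself moves no faster.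
-/
lemma IsConjExpansive.polarLog_exp_mul_exp_sub {N : Seminorm ℝ B} (hN : IsConjExpansive N)
    {p v : B} (hv : IsSelfAdjoint v) :
    N (polarLog (exp p * exp v) - polarLog (exp p)) ≤ N ((2 : ℝ) • v) := by
  let r : ℝ → B := fun t => exp p * exp (t • v)
  have hr (t : ℝ) : HasDerivAt r (exp p * (exp (t • v) * v)) t :=
    (hasDerivAt_exp_smul_const v t).const_mul _
  have hrc : Continuous r := continuous_iff_continuousAt.mpr fun t => (hr t).continuousAt
  have hru (t : ℝ) : IsUnit (r t) := (isUnit_exp' _).mul (isUnit_exp' _)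
  choose z hz hdz hez using fun t => exists_hasDerivAt_polarLog hrc hru (hr t)
  have := N.map_sub_le_of_hasDerivAt hN.continuous (C := N ((2 : ℝ) • v)) hdz fun t _ => by
    refine (hN.le_symDexp (isSelfAdjoint_polarLog (r t)) (hz t)).trans_eq ?_
    obtain ⟨u, hu, e⟩ := exists_eq_exp_mul_unitary (hru t)
    set q := (1 / 2 : ℝ) • polarLog (r t) with hq
    have hqs : IsSelfAdjoint q := (IsSelfAdjoint.all (1 / 2 : ℝ)).smul (isSelfAdjoint_polarLog _)
    have e1 : exp p * (exp (t • v) * v) = r t * v := by simp only [r, mul_assoc]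
    have e2 : symDexp (polarLog (r t)) (z t) = u * ((2 : ℝ) • v) * star u := by
      have e3 : dexp (polarLog (r t)) (z t) = exp q * (u * ((2 : ℝ) • v) * star u) * exp q := by
        rw [hez, e1, star_mul (r t), hv.star_eq, e, star_mul, hqs.exp.star_eq, two_smul]
        noncomm_ring
      rw [symDexp, ← hq, e3]
      calc exp (-q) * (exp q * (u * ((2 : ℝ) • v) * star u) * exp q) * exp (-q)
          = (exp (-q) * exp q) * (u * ((2 : ℝ) • v) * star u) * (exp q * exp (-q)) := by
            simp only [mul_assoc]
        _ = _ := by rw [exp_neg_mul_exp, exp_mul_exp_neg, one_mul, mul_one]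
    rw [e2, hN.unitary_conj u hu]
  simpa [r] using this

/-- The exponential metric increasing property: `polarLog` does not increase distances. -/
lemma IsConjExpansive.polarLog_mul_sub_le {N : Seminorm ℝ B} (hN : IsConjExpansive N) {g h : B}
    (hg : IsUnit g) (hh : IsUnit h) :
    N (polarLog (g * h) - polarLog g) ≤ N (polarLog h) := by
  obtain ⟨u, hu, e⟩ := exists_eq_exp_mul_unitary hg
  set p := (1 / 2 : ℝ) • polarLog g
  have huh : IsUnit (u * h) := (Unitary.toUnits ⟨u, hu⟩).isUnit.mul hh
  -- Writing g = e^p u and u h = e^v w gives g h = e^p e^v w, and the final unitary does not affect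
  -- `polarLog`.
  obtain ⟨w, hw, e'⟩ := exists_eq_exp_mul_unitary huh
  set v := (1 / 2 : ℝ) • polarLog (u * h) with hv
  have hvs : IsSelfAdjoint v := (IsSelfAdjoint.all (1 / 2 : ℝ)).smul (isSelfAdjoint_polarLog _)
  have e1 : polarLog (g * h) = polarLog (exp p * exp v) := by
    rw [e, mul_assoc, e', ← mul_assoc, polarLog_mul_unitary _ hw]
  have e2 : polarLog g = polarLog (exp p) := by rw [e, polarLog_mul_unitary _ hu]
  rw [e1, e2]
  refine (hN.polarLog_exp_mul_exp_sub hvs).trans_eq ?_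
  rw [hv, smul_smul, ← hN.polarLog_unitary_mul hh hu]
  norm_num

lemma IsConjExpansive.polarLog_mul_le {N : Seminorm ℝ B} (hN : IsConjExpansive N) {g h : B}
    (hg : IsUnit g) (hh : IsUnit h) :
    N (polarLog (g * h)) ≤ N (polarLog g) + N (polarLog h) := by
  have h1 := hN.polarLog_mul_sub_le hg hh
  have h2 := map_add_le_add N (polarLog (g * h) - polarLog g) (polarLog g)
  rw [sub_add_cancel] at h2
  linarith

/-- At t = 0 the logarithm is 0, where the differential of exp is the identity. This is the first
variation used at the minimiser. -/
lemma hasDerivAt_polarLog_exp_mul_exp_zero {u v : B} (hu : IsSelfAdjoint u)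
    (hv : IsSelfAdjoint v) :
    HasDerivAt (fun t : ℝ => polarLog (exp (t • u) * exp (t • v))) ((2 : ℝ) • (u + v)) 0 := by
  have h1 (t : ℝ) := (hasDerivAt_exp_smul_const u t).mul (hasDerivAt_exp_smul_const v t)
  have hc : Continuous fun t : ℝ => exp (t • u) * exp (t • v) :=
    continuous_iff_continuousAt.mpr fun t => (h1 t).continuousAt
  obtain ⟨z, hz, hd, he⟩ := exists_hasDerivAt_polarLog hc
    (fun t => (isUnit_exp' _).mul (isUnit_exp' _)) (h1 0)
  have h0 : polarLog (1 : B) = 0 := polarLog_eq_of_exp_eq (.zero B) (by simp)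
  have e : z = (2 : ℝ) • (u + v) := by
    rw [two_smul]
    simpa [h0, dexp_zero, hu.star_eq, hv.star_eq] using he
  rwa [e] at hd

end MetricIncreasing

/-! ### Closed subspaces stable under double commutators. -/

section LieTriple

open NormedSpace Filter Topology

variable {B : Type*} [CStarAlgebra B]

lemma exp_mulLeft_apply (q z : B) : exp (ContinuousLinearMap.mul ℝ B q) z = exp q * z := by
  have h1 := (exp_series_hasSum_exp' (𝕂 := ℝ) (ContinuousLinearMap.mul ℝ B q)).mapL
    (ContinuousLinearMap.apply ℝ B z)
  have h2 := (exp_series_hasSum_exp' (𝕂 := ℝ) q).mul_right z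
  have hp (n : ℕ) : ((ContinuousLinearMap.mul ℝ B q) ^ n) z = q ^ n * z := by
    induction n with
    | zero => simp
    | succ n ih => rw [pow_succ', pow_succ', mul_apply_eq_comp, ih]; simp [mul_assoc]
  simp only [map_smul, ContinuousLinearMap.apply_apply, hp] at h1
  simp only [smul_mul_assoc] at h2
  exact h1.unique h2

lemma exp_mulRight_apply (q z : B) :
    exp ((ContinuousLinearMap.mul ℝ B).flip q) z = z * exp q := by
  have h1 := (exp_series_hasSum_exp' (𝕂 := ℝ) ((ContinuousLinearMap.mul ℝ B).flip q)).mapL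
    (ContinuousLinearMap.apply ℝ B z)
  have h2 := (exp_series_hasSum_exp' (𝕂 := ℝ) q).mul_left z
  have hp (n : ℕ) : (((ContinuousLinearMap.mul ℝ B).flip q) ^ n) z = z * q ^ n := by
    induction n with
    | zero => simp
    | succ n ih => rw [pow_succ', pow_succ, mul_apply_eq_comp, ih]; simp [mul_assoc]
  simp only [map_smul, ContinuousLinearMap.apply_apply, hp] at h1
  simp only [mul_smul_comm] at h2
  exact h1.unique h2

/-- The commutator with `q`, as a continuous linear map. -/
noncomputable def adL (q : B) : B →L[ℝ] B :=
  ContinuousLinearMap.mul ℝ B q - (ContinuousLinearMap.mul ℝ B).flip q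

lemma adL_apply (q z : B) : adL q z = ⁅q, z⁆ := by
  simp [adL, Ring.lie_def]

lemma exp_adL_apply (q z : B) : exp (adL q) z = exp q * z * exp (-q) := by
  have hc : Commute (ContinuousLinearMap.mul ℝ B q) ((ContinuousLinearMap.mul ℝ B).flip (-q)) := by
    ext x; simp [mul_assoc]
  have : adL q = ContinuousLinearMap.mul ℝ B q + (ContinuousLinearMap.mul ℝ B).flip (-q) := by
    rw [adL, map_neg, sub_eq_add_neg]
  rw [this, exp_add_of_commute_real hc, mul_apply_eq_comp, exp_mulRight_apply,
    exp_mulLeft_apply, mul_assoc]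

variable {V : Submodule ℝ B} {q : B}

/-- Odd powers of ad q cancel in the cosh series, even powers preserve V, and V is closed. -/
lemma coshConj_mem (hV : IsClosed (V : Set B)) (hq : ∀ z ∈ V, ⁅q, ⁅q, z⁆⁆ ∈ V) {z : B}
    (hz : z ∈ V) : coshConj q z ∈ V := by
  have h1 := ((exp_series_hasSum_exp' (𝕂 := ℝ) (adL q)).add
    (exp_series_hasSum_exp' (𝕂 := ℝ) (adL (-q)))).mapL (ContinuousLinearMap.apply ℝ B z)
  have hneg : adL (-q) = -adL q := by ext x; simp [adL_apply, Ring.lie_def]; abel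
  have heven (k : ℕ) : ((adL q) ^ (k + k)) z ∈ V := by
    induction k with
    | zero => simpa
    | succ k ih =>
      have : k + 1 + (k + 1) = (k + k) + 1 + 1 := by ring
      rw [this, pow_succ', pow_succ', mul_apply_eq_comp, mul_apply_eq_comp,
        adL_apply, adL_apply]
      exact hq _ ih
  have hpow (n : ℕ) : ((adL (-q)) ^ n) z = (-1 : ℝ) ^ n • ((adL q) ^ n) z := by
    induction n with
    | zero => simp
    | succ n ih =>
      rw [pow_succ', pow_succ' (adL q), mul_apply_eq_comp, mul_apply_eq_comp, ih, hneg, map_smul,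
        pow_succ', mul_smul]
      simp
  have hsum : exp q * z * exp (-q) + exp (-q) * z * exp q ∈ V := by
    have e : (ContinuousLinearMap.apply ℝ B z) (exp (adL q) + exp (adL (-q)))
        = exp q * z * exp (-q) + exp (-q) * z * exp q := by
      simp [exp_adL_apply]
    rw [e] at h1
    refine hV.mem_of_tendsto h1 (Eventually.of_forall fun s => V.sum_mem fun n _ => ?_)
    rw [map_add, map_smul, map_smul]
    simp only [ContinuousLinearMap.apply_apply]
    rw [hpow]
    rcases Nat.even_or_odd n with hn | hn
    · rw [hn.neg_one_pow, one_smul]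
      obtain ⟨k, rfl⟩ := hn
      exact V.add_mem (V.smul_mem _ (heven k)) (V.smul_mem _ (heven k))
    · rw [hn.neg_one_pow]
      simp
  exact V.smul_mem _ hsum

lemma norm_coshConj_le (hq : IsSelfAdjoint q) (z : B) :
    ‖coshConj q z‖ ≤ Real.exp (2 * ‖q‖) * ‖z‖ := by
  have h1 := norm_exp_le_exp_norm_of_isSelfAdjoint hq
  have h2 := norm_exp_le_exp_norm_of_isSelfAdjoint hq.neg
  rw [norm_neg] at h2
  have e : Real.exp (2 * ‖q‖) = Real.exp ‖q‖ * Real.exp ‖q‖ := by rw [← Real.exp_add]; ring_nf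
  have h3 : ‖exp q * z * exp (-q)‖ ≤ Real.exp ‖q‖ * ‖z‖ * Real.exp ‖q‖ :=
    (norm_mul_le _ _).trans (mul_le_mul ((norm_mul_le _ _).trans (by gcongr)) h2
      (norm_nonneg _) (by positivity))
  have h4 : ‖exp (-q) * z * exp q‖ ≤ Real.exp ‖q‖ * ‖z‖ * Real.exp ‖q‖ :=
    (norm_mul_le _ _).trans (mul_le_mul ((norm_mul_le _ _).trans (by gcongr)) h1
      (norm_nonneg _) (by positivity))
  rw [coshConj, norm_smul, e]
  have h5 := norm_add_le (exp q * z * exp (-q)) (exp (-q) * z * exp q)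
  norm_num
  nlinarith

lemma coshConj_sub (q y z : B) : coshConj q (y - z) = coshConj q y - coshConj q z := by
  simp only [coshConj, mul_sub, sub_mul, ← smul_sub]
  congr 1; abel

/-- Repeated duplication writes `symDexp q z` as a product of cosh operators, all preserving V,
applied to `symDexp (q / 2^n) z`. Replacing the latter by z gives approximants in V. -/
lemma symDexp_mem (hV : IsClosed (V : Set B)) (hqs : IsSelfAdjoint q)
    (hq : ∀ z ∈ V, ⁅q, ⁅q, z⁆⁆ ∈ V) {z : B} (hz : z ∈ V) : symDexp q z ∈ V := by
  have hs (c : ℝ) : IsSelfAdjoint (c • q) := (IsSelfAdjoint.all c).smul hqs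
  have hb (c : ℝ) : ∀ y ∈ V, ⁅c • q, ⁅c • q, y⁆⁆ ∈ V := fun y hy => by
    have e : ⁅c • q, ⁅c • q, y⁆⁆ = c • c • ⁅q, ⁅q, y⁆⁆ := by
      simp only [Ring.lie_def, smul_mul_assoc, mul_smul_comm, ← smul_sub]
    rw [e]
    exact V.smul_mem _ (V.smul_mem _ (hq y hy))
  -- The error factor does not depend on n: the first cosh costs exp(c‖q‖/2), and the induction
  -- hypothesis at c/2 accounts for the other half of the exponent.
  have key : ∀ n : ℕ, ∀ c : ℝ, 0 ≤ c → ∃ v ∈ V, ‖symDexp (c • q) z - v‖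
      ≤ Real.exp (c * ‖q‖) * ‖symDexp (((1 / 2 : ℝ) ^ n) • c • q) z - z‖ := by
    intro n
    induction n with
    | zero =>
      intro c hc
      refine ⟨z, hz, ?_⟩
      rw [pow_zero, one_smul]
      exact le_mul_of_one_le_left (norm_nonneg _) (Real.one_le_exp (by positivity))
    | succ n ih =>
      intro c hc
      obtain ⟨v, hv, h⟩ := ih (1 / 2 * c) (by positivity)
      refine ⟨coshConj ((1 / 4 : ℝ) • c • q) v,
        coshConj_mem hV (by rw [smul_smul]; exact hb _) hv, ?_⟩
      rw [symDexp_eq_coshConj, ← coshConj_sub]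
      refine (norm_coshConj_le (by rw [smul_smul]; exact hs _) _).trans ?_
      rw [mul_smul] at h
      have e1 : ((1 / 2 : ℝ) ^ n) • (1 / 2 : ℝ) • c • q = ((1 / 2 : ℝ) ^ (n + 1)) • c • q := by
        rw [smul_smul, pow_succ]
      rw [e1] at h
      refine (mul_le_mul_of_nonneg_left h (Real.exp_nonneg _)).trans_eq ?_
      rw [← mul_assoc, ← Real.exp_add, norm_smul, norm_smul, Real.norm_of_nonneg hc]
      norm_num
      left
      ring
  choose v hv hle using fun n => key n 1 zero_le_one
  simp only [one_smul, one_mul] at hle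
  have ht : Tendsto v atTop (𝓝 (symDexp q z)) := by
    rw [tendsto_iff_norm_sub_tendsto_zero]
    have h2 : Tendsto (fun n : ℕ => Real.exp ‖q‖ * ‖symDexp (((1 / 2 : ℝ) ^ n) • q) z - z‖)
        atTop (𝓝 (Real.exp ‖q‖ * 0)) :=
      (tendsto_iff_norm_sub_tendsto_zero.mp (tendsto_symDexp_pow q z)).const_mul _
    rw [mul_zero] at h2
    refine squeeze_zero (fun _ => norm_nonneg _) (fun n => ?_) h2
    rw [norm_sub_rev]
    exact hle n
  exact hV.mem_of_tendsto ht (Eventually.of_forall hv)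

end LieTriple

/-! ### Geodesic convexity of the exponentials of H. -/

section GeodesicallyConvex

open NormedSpace Filter Topology

variable {B : Type*} [CStarAlgebra B]

/-- `symDexp` as a continuous linear map. -/
noncomputable def symDexpL (q : B) : B →L[ℝ] B :=
  (ContinuousLinearMap.mulLeftRight ℝ B (exp (-((1 / 2 : ℝ) • q)))
    (exp (-((1 / 2 : ℝ) • q)))).comp (dexp q)

lemma symDexpL_apply (q z : B) : symDexpL q z = symDexp q z := by
  simp [symDexpL, symDexp]

lemma contDiff_symDexpL : ContDiff ℝ 1 (symDexpL : B → B →L[ℝ] B) := by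
  have h1 := contDiff_dexp (B := B)
  have h2 : ContDiff ℝ 1 (exp : B → B) := contDiff_exp.of_le (by norm_num)
  have h3 : ContDiff ℝ 1 fun q : B => exp (-((1 / 2 : ℝ) • q)) := by fun_prop
  have h4 : ContDiff ℝ 1 fun q : B =>
      ContinuousLinearMap.mulLeftRight ℝ B (exp (-((1 / 2 : ℝ) • q)))
        (exp (-((1 / 2 : ℝ) • q))) := by
    have h5 : ContDiff ℝ 1 fun q : B =>
        ContinuousLinearMap.mulLeftRight ℝ B (exp (-((1 / 2 : ℝ) • q))) :=
      (ContinuousLinearMap.contDiff _).comp h3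
    exact h5.clm_apply h3
  exact h4.clm_comp h1

lemma contDiff_coshConj (x : B) : ContDiff ℝ 1 fun q : B => coshConj q x := by
  have h2 : ContDiff ℝ 1 (exp : B → B) := contDiff_exp.of_le (by norm_num)
  unfold coshConj
  fun_prop

/-- The hypothesis is the differential equation of the logarithm along e^{tx} e^v; conjugating by
e^{-q/2} makes the right side 2 cosh(ad q / 2) x. -/
lemma symDexp_eq_of_dexp_eq {q z x : B}
    (h : dexp q z = x * exp q + exp q * x) :
    symDexp q z = (2 : ℝ) • coshConj ((1 / 2 : ℝ) • q) x := by
  have h1 := exp_neg_mul_exp ((1 / 2 : ℝ) • q)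
  have h2 := exp_mul_exp_neg ((1 / 2 : ℝ) • q)
  rw [symDexp, h, ← exp_half_mul_exp_half q, coshConj, smul_smul]
  set a := exp ((1 / 2 : ℝ) • q)
  set b := exp (-((1 / 2 : ℝ) • q))
  have ba (x : B) : b * (a * x) = x := by rw [← mul_assoc, h1, one_mul]
  simp only [mul_add, add_mul, mul_assoc, ba, h2, mul_one]
  norm_num
  rw [add_comm]

/-- A splitting `E` of the selfadjoint part of `B` along two closed subspaces which are invariant
under the double commutators with the elements of the first one. -/
structure IsTripleSplitting (H S : Submodule ℝ B) (E : B →L[ℝ] B) : Prop where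
  closed_left : IsClosed (H : Set B)
  closed_right : IsClosed (S : Set B)
  isSelfAdjoint_left : ∀ x ∈ H, IsSelfAdjoint x
  isSelfAdjoint_right : ∀ x ∈ S, IsSelfAdjoint x
  disjoint : ∀ x ∈ H, x ∈ S → x = 0
  map_mem : ∀ z, IsSelfAdjoint z → E z ∈ H
  sub_mem : ∀ z, IsSelfAdjoint z → z - E z ∈ S
  lie_left : ∀ q ∈ H, ∀ z ∈ H, ⁅q, ⁅q, z⁆⁆ ∈ H
  lie_right : ∀ q ∈ H, ∀ z ∈ S, ⁅q, ⁅q, z⁆⁆ ∈ S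

namespace IsTripleSplitting

variable {H S : Submodule ℝ B} {E : B →L[ℝ] B}

lemma map_add_eq (hE : IsTripleSplitting H S E) {x y : B} (hx : x ∈ H) (hy : y ∈ S) :
    E (x + y) = x := by
  have hs : IsSelfAdjoint (x + y) :=
    (hE.isSelfAdjoint_left x hx).add (hE.isSelfAdjoint_right y hy)
  have h1 : x - E (x + y) ∈ H := H.sub_mem hx (hE.map_mem _ hs)
  have h2 : x - E (x + y) ∈ S := by
    have : x - E (x + y) = (x + y - E (x + y)) - y := by abel
    rw [this]
    exact S.sub_mem (hE.sub_mem _ hs) hy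
  exact (sub_eq_zero.mp (hE.disjoint _ h1 h2)).symm

lemma map_of_mem (hE : IsTripleSplitting H S E) {x : B} (hx : x ∈ H) : E x = x := by
  simpa using hE.map_add_eq hx S.zero_mem

/-- For q in H the operators preserve the splitting, so z would lie in H. In general they are
evaluated at E q instead, 1 - E kills the part in H, and only the differences between q and E q
remain. The expansion bound then controls the S-component of z. -/
lemma norm_sub_map_le (hE : IsTripleSplitting H S E) {q z x : B} (hq : IsSelfAdjoint q)
    (hz : IsSelfAdjoint z) (hx : x ∈ H)
    (h : symDexp q z = (2 : ℝ) • coshConj ((1 / 2 : ℝ) • q) x) :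
    ‖z - E z‖ ≤ ‖ContinuousLinearMap.id ℝ B - E‖ *
      (2 * ‖coshConj ((1 / 2 : ℝ) • q) x - coshConj ((1 / 2 : ℝ) • E q) x‖
        + ‖symDexpL (E q) - symDexpL q‖ * ‖z‖) := by
  have hEq : E q ∈ H := hE.map_mem q hq
  have hEqs := hE.isSelfAdjoint_left _ hEq
  have hlie (c : ℝ) : ∀ y ∈ H, ⁅c • E q, ⁅c • E q, y⁆⁆ ∈ H := hE.lie_left _ (H.smul_mem c hEq)
  have h1 : symDexp (E q) (E z) ∈ H :=
    symDexp_mem hE.closed_left hEqs (hE.lie_left _ hEq) (hE.map_mem z hz)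
  have h2 : symDexp (E q) (z - E z) ∈ S :=
    symDexp_mem hE.closed_right hEqs (hE.lie_right _ hEq) (hE.sub_mem z hz)
  have h3 : symDexp (E q) z = symDexp (E q) (E z) + symDexp (E q) (z - E z) := by
    simp only [← symDexpL_apply]
    rw [← map_add, add_sub_cancel]
  have h4 : symDexp (E q) (z - E z) = (ContinuousLinearMap.id ℝ B - E) (symDexp (E q) z) := by
    have := hE.map_add_eq h1 h2
    rw [← h3] at this
    simp only [sub_apply, ContinuousLinearMap.id_apply]
    rw [this, h3]; abel
  have hc : coshConj ((1 / 2 : ℝ) • E q) x ∈ H := coshConj_mem hE.closed_left (hlie _) hx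
  have h5 : symDexp (E q) z = (2 : ℝ) • coshConj ((1 / 2 : ℝ) • E q) x
      + ((2 : ℝ) • (coshConj ((1 / 2 : ℝ) • q) x - coshConj ((1 / 2 : ℝ) • E q) x)
        + (symDexpL (E q) - symDexpL q) z) := by
    rw [sub_apply, symDexpL_apply, symDexpL_apply, h, smul_sub]
    abel
  have h6 : (ContinuousLinearMap.id ℝ B - E) ((2 : ℝ) • coshConj ((1 / 2 : ℝ) • E q) x) = 0 := by
    simp only [sub_apply, ContinuousLinearMap.id_apply]
    rw [hE.map_of_mem (H.smul_mem _ hc), sub_self]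
  have h7 : ‖z - E z‖ ≤ ‖symDexp (E q) (z - E z)‖ :=
    norm_le_norm_symDexp hEqs (hE.isSelfAdjoint_right _ (hE.sub_mem z hz))
  rw [h4, h5, map_add, h6, zero_add] at h7
  refine h7.trans ((ContinuousLinearMap.le_opNorm _ _).trans ?_)
  refine mul_le_mul_of_nonneg_left ((norm_add_le _ _).trans ?_) (norm_nonneg _)
  refine add_le_add ?_ (ContinuousLinearMap.le_opNorm _ _)
  rw [norm_smul]; norm_num

/-- The logarithm q of e^{tx} e^v starts at 2v in H, and its S-component q - E q satisfies a linear
differential inequality with zero initial value. Gronwall makes it vanish a little beyond any time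
at which q is in H; closedness of H extends this to all of [0, 1]. -/
lemma polarLog_exp_mul_exp_mem (hE : IsTripleSplitting H S E) {x v : B} (hx : x ∈ H)
    (hv : v ∈ H) : polarLog (exp x * exp v) ∈ H := by
  have hxs := hE.isSelfAdjoint_left x hx
  have hvs := hE.isSelfAdjoint_left v hv
  let g : ℝ → B := fun t => exp (t • x) * exp v
  have hg (t : ℝ) : HasDerivAt g (x * g t) t := by
    have := (hasDerivAt_exp_smul_const' x t).mul_const (exp v)
    rwa [mul_assoc] at this
  have hgc : Continuous g := continuous_iff_continuousAt.mpr fun t => (hg t).continuousAt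
  have hgu (t : ℝ) : IsUnit (g t) := (isUnit_exp' _).mul (isUnit_exp' _)
  choose z hz hdz hez using fun t => exists_hasDerivAt_polarLog hgc hgu (hg t)
  let q : ℝ → B := fun t => polarLog (g t)
  have hq : Continuous q := continuous_polarLog hgc hgu
  have hqs (t : ℝ) : IsSelfAdjoint (q t) := isSelfAdjoint_polarLog _
  have hW (t : ℝ) : symDexp (q t) (z t) = (2 : ℝ) • coshConj ((1 / 2 : ℝ) • q t) x := by
    refine symDexp_eq_of_dexp_eq ?_
    rw [hez, exp_polarLog (hgu t), star_mul x, hxs.star_eq]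
    simp only [mul_assoc]
  have hcl : IsClosed {t : ℝ | q t ∈ H} := hE.closed_left.preimage hq
  have hC : ContDiff ℝ 1 fun p : B => coshConj ((1 / 2 : ℝ) • p) x :=
    (contDiff_coshConj x).comp (contDiff_const_smul _)
  have key : Set.Icc (0 : ℝ) 1 ⊆ {t : ℝ | q t ∈ H} := by
    refine (hcl.inter isClosed_Icc).Icc_subset_of_forall_mem_nhdsWithin ?_ ?_
    · simp only [Set.mem_ofPred_eq, q, g, zero_smul, exp_zero, one_mul, polarLog_exp hvs]
      exact H.smul_mem _ hv
    · rintro t₀ ⟨ht₀ : q t₀ ∈ H, -⟩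
      obtain ⟨K₁, U₁, hU₁, hL₁⟩ := (contDiff_symDexpL.contDiffAt (x := q t₀)).exists_lipschitzOnWith
      obtain ⟨K₂, U₂, hU₂, hL₂⟩ := (hC.contDiffAt (x := q t₀)).exists_lipschitzOnWith
      have hn1 : ∀ᶠ t in 𝓝 t₀, q t ∈ U₁ ∩ U₂ :=
        hq.continuousAt.eventually_mem (inter_mem hU₁ hU₂)
      -- Since E fixes q t₀, both q t and E (q t) stay where the Lipschitz bounds hold.
      have hn2 : ∀ᶠ t in 𝓝 t₀, E (q t) ∈ U₁ ∩ U₂ := by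
        have : ContinuousAt (fun t => E (q t)) t₀ := by fun_prop
        refine this.eventually_mem ?_
        rw [hE.map_of_mem ht₀]
        exact inter_mem hU₁ hU₂
      set M := ‖coshConj ((1 / 2 : ℝ) • q t₀) x‖ + 1 with hM
      have hn3 : ∀ᶠ t in 𝓝 t₀, ‖coshConj ((1 / 2 : ℝ) • q t) x‖ < M :=
        ((hC.continuous.comp hq).norm.tendsto t₀).eventually_lt_const (lt_add_one _)
      obtain ⟨ε, hε, hball⟩ := Metric.eventually_nhds_iff_ball.mp (hn1.and (hn2.and hn3))
      have hIcc : ∀ t ∈ Set.Icc t₀ (t₀ + ε / 2), t ∈ Metric.ball t₀ ε := by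
        intro t ht
        rw [Metric.mem_ball, Real.dist_eq, abs_of_nonneg (by linarith [ht.1])]
        linarith [ht.2]
      -- With δ = 0 and ε = 0 the Gronwall bound is identically zero. In K, the factor 2M bounds the
      -- velocity z.
      have hgr := norm_le_gronwallBound_of_norm_deriv_right_le
        (f := fun t => q t - E (q t)) (f' := fun t => z t - E (z t)) (δ := 0) (ε := 0)
        (K := ‖ContinuousLinearMap.id ℝ B - E‖ * (2 * K₂ + K₁ * (2 * M)))
        (a := t₀) (b := t₀ + ε / 2) (by fun_prop)
        (fun t _ => ((hdz t).sub (E.hasFDerivAt.comp_hasDerivAt t (hdz t))).hasDerivWithinAt)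
        (by rw [hE.map_of_mem ht₀, sub_self, norm_zero])
        (fun t ht => by
          obtain ⟨⟨ha1, ha2⟩, ⟨hb1, hb2⟩, hc⟩ := hball t (hIcc t ⟨ht.1, ht.2.le⟩)
          have hzM : ‖z t‖ ≤ 2 * M := by
            refine (norm_le_norm_symDexp (hqs t) (hz t)).trans ?_
            rw [hW, norm_smul]
            norm_num
            exact hc.le
          have l1 := hL₁.norm_sub_le hb1 ha1
          have l2 := hL₂.norm_sub_le ha2 hb2
          rw [norm_sub_rev (E (q t))] at l1
          rw [add_zero, mul_assoc]
          refine (hE.norm_sub_map_le (hqs t) (hz t) hx (hW t)).trans ?_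
          refine mul_le_mul_of_nonneg_left ?_ (norm_nonneg _)
          have l3 := mul_le_mul l1 hzM (norm_nonneg _) (by positivity)
          nlinarith)
      have : Set.Icc t₀ (t₀ + ε / 2) ∈ 𝓝[>] t₀ := Icc_mem_nhdsGT (by linarith)
      filter_upwards [this] with t ht
      have h0 := hgr t ht
      rw [gronwallBound_ε0, zero_mul, norm_le_zero_iff, sub_eq_zero] at h0
      show q t ∈ H
      rw [h0]
      exact hE.map_mem _ (hqs t)
  have := key (Set.right_mem_Icc.mpr zero_le_one)
  simpa [q, g] using this

end IsTripleSplitting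

end GeodesicallyConvex

/-! ### The trace seminorm and its expansion property. -/

section TraceSeminorm

open NormedSpace Filter Topology
open scoped ComplexOrder

variable {B : Type*} [CStarAlgebra B]

/-- A faithful positive trace on a C*-algebra. -/
structure IsFaithfulTrace (τ : B →ₗ[ℂ] ℂ) : Prop where
  nonneg : ∀ a, 0 ≤ τ (star a * a)
  trace_comm : ∀ a b, τ (a * b) = τ (b * a)
  faithful : ∀ a, τ (star a * a) = 0 → a = 0

namespace IsFaithfulTrace

variable {τ : B →ₗ[ℂ] ℂ}

lemma map_real_smul (c : ℝ) (a : B) : τ (c • a) = c * τ a := by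
  rw [← Complex.coe_smul, map_smul, smul_eq_mul]

/-- Polarisation: τ is real on b*b for b = a + 1 and b = a + i, which determines the imaginary and
the real part of τ(a*). -/
lemma map_star (hτ : IsFaithfulTrace τ) (a : B) : τ (star a) = star (τ a) := by
  have h1 := (Complex.nonneg_iff.mp (hτ.nonneg (a + 1))).2
  have h2 := (Complex.nonneg_iff.mp (hτ.nonneg (a + Complex.I • (1 : B)))).2
  have h3 := (Complex.nonneg_iff.mp (hτ.nonneg a)).2
  have h4 := (Complex.nonneg_iff.mp (hτ.nonneg 1)).2
  simp only [star_one, mul_one] at h4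
  simp [add_mul, mul_add] at h1 h2
  apply Complex.ext
  · simp; linarith
  · simp; linarith

/-- The real inner product of a trace. -/
@[reducible]
noncomputable def preInnerCore (hτ : IsFaithfulTrace τ) : PreInnerProductSpace.Core ℝ B where
  inner a b := (τ (star a * b)).re
  conj_inner_symm a b := by
    have := hτ.map_star (star a * b)
    rw [star_mul, star_star] at this
    rw [this]
    simp
  re_inner_nonneg a := (Complex.nonneg_iff.mp (hτ.nonneg a)).1
  add_left a b c := by simp [add_mul]
  smul_left a b r := by
    rw [star_smul, smul_mul_assoc]
    simp only [star_trivial, map_real_smul]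
    simp

/-- The seminorm `a ↦ τ (star a * a) ^ (1 / 2)` of a trace. -/
noncomputable def seminorm (hτ : IsFaithfulTrace τ) : Seminorm ℝ B :=
  Seminorm.of (fun a => √(τ (star a * a)).re)
    (fun a b => by
      let := hτ.preInnerCore
      let := InnerProductSpace.Core.toSeminormedAddCommGroup (𝕜 := ℝ) (F := B)
      exact norm_add_le a b)
    (fun c a => by
      rw [star_smul, smul_mul_assoc, mul_smul_comm, smul_smul, map_real_smul]
      simp only [star_trivial]
      rw [Complex.re_ofReal_mul, Real.sqrt_mul (mul_self_nonneg c), Real.sqrt_mul_self_eq_abs]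
      rfl)

lemma seminorm_apply (hτ : IsFaithfulTrace τ) (a : B) :
    hτ.seminorm a = √(τ (star a * a)).re := rfl

lemma seminorm_sq (hτ : IsFaithfulTrace τ) (a : B) :
    hτ.seminorm a ^ 2 = (τ (star a * a)).re := by
  rw [seminorm_apply, Real.sq_sqrt (Complex.nonneg_iff.mp (hτ.nonneg a)).1]

lemma seminorm_star (hτ : IsFaithfulTrace τ) (a : B) :
    hτ.seminorm (star a) = hτ.seminorm a := by
  rw [seminorm_apply, seminorm_apply, star_star, hτ.trace_comm]

lemma eq_zero_of_seminorm_eq_zero (hτ : IsFaithfulTrace τ) {a : B} (h : hτ.seminorm a = 0) :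
    a = 0 := by
  have h1 := hτ.seminorm_sq a
  rw [h] at h1
  refine hτ.faithful a (Complex.ext ?_ ?_)
  · simpa using h1.symm
  · exact (Complex.nonneg_iff.mp (hτ.nonneg a)).2.symm

lemma re_nonneg_of_nonneg [PartialOrder B] [StarOrderedRing B] (hτ : IsFaithfulTrace τ) {a : B}
    (ha : 0 ≤ a) : 0 ≤ (τ a).re := by
  have h := CFC.sqrt_mul_sqrt_self a ha
  have := hτ.nonneg (CFC.sqrt a)
  rw [(CFC.sqrt_nonneg a).isSelfAdjoint.star_eq, h] at this
  exact (Complex.nonneg_iff.mp this).1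

lemma re_mono [PartialOrder B] [StarOrderedRing B] (hτ : IsFaithfulTrace τ) {a b : B}
    (hab : a ≤ b) : (τ a).re ≤ (τ b).re := by
  have := hτ.re_nonneg_of_nonneg (sub_nonneg.mpr hab)
  rw [map_sub, Complex.sub_re] at this
  linarith

lemma seminorm_mul_le_left (hτ : IsFaithfulTrace τ) (a b : B) :
    hτ.seminorm (a * b) ≤ ‖a‖ * hτ.seminorm b := by
  let := CStarAlgebra.spectralOrder B
  let := CStarAlgebra.spectralOrderedRing B
  refine le_of_sq_le_sq ?_ (mul_nonneg (norm_nonneg _) (apply_nonneg _ _))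
  rw [mul_pow, hτ.seminorm_sq, hτ.seminorm_sq]
  have h : star b * (star a * a) * b ≤ (‖a‖ ^ 2) • (star b * b) := by
    rw [sq, ← CStarRing.norm_star_mul_self (x := a)]
    exact CStarAlgebra.star_left_conjugate_le_norm_smul
  have h2 := hτ.re_mono h
  rw [map_real_smul, Complex.re_ofReal_mul] at h2
  refine le_trans (le_of_eq ?_) h2
  rw [star_mul]; simp only [mul_assoc]

lemma seminorm_mul_le_right (hτ : IsFaithfulTrace τ) (a b : B) :
    hτ.seminorm (a * b) ≤ hτ.seminorm a * ‖b‖ := by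
  rw [← hτ.seminorm_star (a * b), star_mul, ← hτ.seminorm_star a, ← norm_star b, mul_comm]
  exact hτ.seminorm_mul_le_left _ _

lemma seminorm_le_norm (hτ : IsFaithfulTrace τ) (a : B) :
    hτ.seminorm a ≤ hτ.seminorm 1 * ‖a‖ := by
  simpa using hτ.seminorm_mul_le_right 1 a

lemma continuous_seminorm (hτ : IsFaithfulTrace τ) : Continuous hτ.seminorm := by
  refine Seminorm.continuous_of_continuousAt_zero ?_
  rw [ContinuousAt, map_zero]
  refine squeeze_zero (fun _ => apply_nonneg _ _) hτ.seminorm_le_norm ?_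
  have : Continuous fun a : B => hτ.seminorm 1 * ‖a‖ := by fun_prop
  simpa using this.tendsto 0

lemma seminorm_add_sq (hτ : IsFaithfulTrace τ) (a b : B) :
    hτ.seminorm (a + b) ^ 2
      = hτ.seminorm a ^ 2 + hτ.seminorm b ^ 2 + 2 * (τ (star a * b)).re := by
  have h : (τ (star b * a)).re = (τ (star a * b)).re := by
    have := hτ.map_star (star a * b)
    rw [star_mul, star_star] at this
    rw [this]; simp
  rw [hτ.seminorm_sq, hτ.seminorm_sq, hτ.seminorm_sq, star_add, add_mul, mul_add, mul_add]
  simp only [map_add, Complex.add_re]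
  linarith

lemma seminorm_add_sq_add_sub_sq (hτ : IsFaithfulTrace τ) (a b : B) :
    hτ.seminorm (a + b) ^ 2 + hτ.seminorm (a - b) ^ 2
      = 2 * hτ.seminorm a ^ 2 + 2 * hτ.seminorm b ^ 2 := by
  rw [sub_eq_add_neg, hτ.seminorm_add_sq, hτ.seminorm_add_sq, map_neg_eq_map, mul_neg, map_neg,
    Complex.neg_re]
  ring

/-- For T = e^q z e^{-q}, ‖T + T*‖² = ‖T - T*‖² + 4 Re τ(T²) in the trace norm, and τ(T²) = τ(z²) by
the trace property. -/
lemma seminorm_le_coshConj (hτ : IsFaithfulTrace τ) {q z : B} (hq : IsSelfAdjoint q)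
    (hz : IsSelfAdjoint z) : hτ.seminorm z ≤ hτ.seminorm (coshConj q z) := by
  set T := exp q * z * exp (-q) with hT
  have hstar : star T = exp (-q) * z * exp q := by
    rw [hT, star_mul, star_mul, hz.star_eq, hq.exp.star_eq, hq.neg.exp.star_eq, mul_assoc]
  have hTT : τ (T * T) = τ (z * z) := by
    have : T * T = exp q * (z * z * exp (-q)) := by
      calc T * T = exp q * z * (exp (-q) * exp q) * z * exp (-q) := by
            rw [hT]; simp only [mul_assoc]
        _ = _ := by rw [exp_neg_mul_exp, mul_one]; simp only [mul_assoc]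
    rw [this, hτ.trace_comm, mul_assoc, exp_neg_mul_exp, mul_one]
  have h1 := hτ.seminorm_sq (T + star T)
  have h2 := hτ.seminorm_sq (T - star T)
  have h3 := hτ.map_star (T * T)
  rw [star_mul] at h3
  have h4 := hτ.seminorm_sq z
  rw [hz.star_eq, ← hTT] at h4
  have e1 : star (T + star T) * (T + star T)
      = star T * T + star T * star T + (T * T + T * star T) := by
    rw [star_add, star_star]; noncomm_ring
  have e2 : star (T - star T) * (T - star T)
      = star T * T - star T * star T - (T * T - T * star T) := by
    rw [star_sub, star_star]; noncomm_ring
  rw [e1] at h1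
  rw [e2] at h2
  simp only [map_add, map_sub, Complex.add_re, Complex.sub_re, h3, Complex.star_def,
    Complex.conj_re] at h1 h2
  have h5 : hτ.seminorm (coshConj q z) = 1 / 2 * hτ.seminorm (T + star T) := by
    rw [hstar, coshConj, map_smul_eq_mul, ← hT]; norm_num
  have h6 := sq_nonneg (hτ.seminorm (T - star T))
  refine le_of_sq_le_sq ?_ (apply_nonneg _ _)
  rw [h5, mul_pow]
  nlinarith

lemma isConjExpansive (hτ : IsFaithfulTrace τ) : IsConjExpansive hτ.seminorm where
  continuous := hτ.continuous_seminorm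
  unitary_conj u hu z := by
    rw [seminorm_apply, seminorm_apply, star_mul, star_mul, star_star]
    have : u * (star z * star u) * (u * z * star u) = u * (star z * z * star u) := by
      calc u * (star z * star u) * (u * z * star u)
          = u * star z * (star u * u) * z * star u := by simp only [mul_assoc]
        _ = _ := by rw [Unitary.star_mul_self_of_mem hu, mul_one]; simp only [mul_assoc]
    rw [this, hτ.trace_comm, mul_assoc, Unitary.star_mul_self_of_mem hu, mul_one]
  le_coshConj _ _ hq hz := hτ.seminorm_le_coshConj hq hz

/-- Duhamel's interpolation e^{tx} e^{(1-t)y} has derivative e^{tx}(x - y)e^{(1-t)y}. -/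
lemma seminorm_exp_sub_exp_le (hτ : IsFaithfulTrace τ) {x y : B} {M : ℝ} (hx : IsSelfAdjoint x)
    (hy : IsSelfAdjoint y) (hxM : ‖x‖ ≤ M) (hyM : ‖y‖ ≤ M) :
    hτ.seminorm (exp x - exp y) ≤ Real.exp M * hτ.seminorm (x - y) := by
  let f : ℝ → B := fun t => exp (t • x) * exp ((1 - t) • y)
  have hf (t : ℝ) : HasDerivAt f (exp (t • x) * (x - y) * exp ((1 - t) • y)) t := by
    have h1 : HasDerivAt (fun t : ℝ => exp ((1 - t) • y)) (-(y * exp ((1 - t) • y))) t := by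
      have := (hasDerivAt_exp_smul_const' y (1 - t)).scomp t ((hasDerivAt_id t).const_sub 1)
      rw [neg_one_smul] at this
      exact this
    refine ((hasDerivAt_exp_smul_const x t).mul h1).congr_deriv ?_
    rw [mul_sub, sub_mul, mul_neg, ← sub_eq_add_neg]
    simp only [mul_assoc]
  have := hτ.seminorm.map_sub_le_of_hasDerivAt hτ.continuous_seminorm hf
    (C := Real.exp M * hτ.seminorm (x - y)) fun t ht => by
      have h1 : ‖exp (t • x)‖ ≤ Real.exp (t * M) := by
        refine (norm_exp_le_exp_norm_of_isSelfAdjoint ((IsSelfAdjoint.all t).smul hx)).trans ?_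
        rw [Real.exp_le_exp, norm_smul, Real.norm_of_nonneg ht.1]
        exact mul_le_mul_of_nonneg_left hxM ht.1
      have h2 : ‖exp ((1 - t) • y)‖ ≤ Real.exp ((1 - t) * M) := by
        refine (norm_exp_le_exp_norm_of_isSelfAdjoint
          ((IsSelfAdjoint.all (1 - t)).smul hy)).trans ?_
        have h0 : 0 ≤ 1 - t := by linarith [ht.2]
        rw [Real.exp_le_exp, norm_smul, Real.norm_of_nonneg h0]
        exact mul_le_mul_of_nonneg_left hyM h0
      have h3 : Real.exp M = Real.exp (t * M) * Real.exp ((1 - t) * M) := by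
        rw [← Real.exp_add]; ring_nf
      calc hτ.seminorm (exp (t • x) * (x - y) * exp ((1 - t) • y))
          ≤ hτ.seminorm (exp (t • x) * (x - y)) * ‖exp ((1 - t) • y)‖ :=
            hτ.seminorm_mul_le_right _ _
        _ ≤ (‖exp (t • x)‖ * hτ.seminorm (x - y)) * ‖exp ((1 - t) • y)‖ :=
            mul_le_mul_of_nonneg_right (hτ.seminorm_mul_le_left _ _) (norm_nonneg _)
        _ ≤ (Real.exp (t * M) * hτ.seminorm (x - y)) * Real.exp ((1 - t) * M) := by
            have := apply_nonneg hτ.seminorm (x - y)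
            gcongr
        _ = _ := by rw [h3]; ring
  simpa [f] using this

/-- The scalar bound |s| ≤ e^M |e^s - 1| for |s| ≤ M, squared, passes through the functional
calculus and the positive functional τ. -/
lemma seminorm_le_exp_sub_one (hτ : IsFaithfulTrace τ) {w : B} {M : ℝ} (hw : IsSelfAdjoint w)
    (hM : ‖w‖ ≤ M) : hτ.seminorm w ≤ Real.exp M * hτ.seminorm (exp w - 1) := by
  let := CStarAlgebra.spectralOrder B
  let := CStarAlgebra.spectralOrderedRing B
  have hle : w * w ≤ (Real.exp M ^ 2) • ((exp w - 1) * (exp w - 1)) := by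
    have e1 : w * w = cfc (fun s : ℝ => s * s) w := by
      rw [cfc_mul _ _ w, cfc_id' ℝ w]
    have e2 : (Real.exp M ^ 2) • ((exp w - 1) * (exp w - 1))
        = cfc (fun s : ℝ => (Real.exp M ^ 2) • ((Real.exp s - 1) * (Real.exp s - 1))) w := by
      rw [cfc_smul _ _ w, cfc_mul _ _ w, cfc_sub _ _ w, CFC.real_exp_eq_normedSpace_exp hw,
        cfc_const_one ℝ w]
    rw [e1, e2]
    refine cfc_mono fun s hs => ?_
    have : Nontrivial B := by
      by_contra h
      rw [not_nontrivial_iff_subsingleton] at h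
      simp at hs
    have hsM : |s| ≤ M := (spectrum.norm_le_norm_of_mem hs).trans hM
    have h1 : |s| ≤ Real.exp M * |Real.exp s - 1| := by
      rcases le_total 0 s with h | h
      · have h2 := Real.add_one_le_exp s
        have h3 := Real.one_le_exp ((abs_nonneg s).trans hsM)
        rw [abs_of_nonneg h, abs_of_nonneg (by linarith)]
        nlinarith
      · have h2 := Real.add_one_le_exp (-s)
        have h3 : Real.exp (-s) ≤ Real.exp M :=
          Real.exp_le_exp.mpr ((neg_le_abs s).trans hsM)
        have h4 : Real.exp (-s) * Real.exp s = 1 := by rw [← Real.exp_add]; simp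
        have h5 : Real.exp s ≤ 1 := Real.exp_le_one_iff.mpr h
        rw [abs_of_nonpos h, abs_of_nonpos (by linarith)]
        nlinarith
    have h2 := mul_self_le_mul_self (abs_nonneg s) h1
    rw [abs_mul_abs_self] at h2
    refine h2.trans_eq ?_
    rw [smul_eq_mul, ← abs_mul_abs_self (Real.exp s - 1)]
    ring
  have h1 := hτ.re_mono hle
  rw [map_real_smul] at h1
  rw [Complex.re_ofReal_mul] at h1
  refine le_of_sq_le_sq ?_ (mul_nonneg (Real.exp_nonneg _) (apply_nonneg _ _))
  rw [mul_pow, hτ.seminorm_sq, hτ.seminorm_sq, hw.star_eq, star_sub, star_one, hw.exp.star_eq]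
  exact h1

end IsFaithfulTrace

end TraceSeminorm

/-! ### The foot of the perpendicular: uniqueness and existence. -/

section Decomposition

open NormedSpace Filter Topology

variable {B : Type*} [CStarAlgebra B]

lemma eventually_seminorm_le_mul (N : Seminorm ℝ B) (hN : Continuous N) {f : ℝ → B} {d : B}
    {c : ℝ} (hf : HasDerivAt f d 0) (h0 : f 0 = 0) (hc : N d < c) :
    ∀ᶠ t in 𝓝[>] (0 : ℝ), N (f t) ≤ c * t := by
  have h1 : Tendsto (fun t => N (slope f 0 t)) (𝓝[>] 0) (𝓝 (N d)) :=
    (hN.tendsto _).comp ((hasDerivAt_iff_tendsto_slope.mp hf).mono_left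
      (nhdsWithin_mono _ fun y (hy : 0 < y) => hy.ne'))
  filter_upwards [h1.eventually_lt_const hc, self_mem_nhdsWithin] with t ht (htpos : 0 < t)
  rw [slope_def_module, h0, sub_zero, sub_zero, map_smul_eq_mul,
    Real.norm_of_nonneg (by positivity)] at ht
  rw [inv_mul_lt_iff₀ htpos] at ht
  linarith

lemma exp_neg_mul_of_eq {m p u : B} (h : m = exp p * u) :
    exp (-p) * m = u := by
  rw [h, ← mul_assoc, exp_neg_mul_exp, one_mul]

lemma polarLog_exp_half {v : B} (hv : IsSelfAdjoint v) :
    polarLog (exp ((1 / 2 : ℝ) • v)) = v := by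
  rw [polarLog_exp ((IsSelfAdjoint.all (1 / 2 : ℝ)).smul hv), smul_smul]
  norm_num

namespace IsTripleSplitting

variable {H S : Submodule ℝ B} {E : B →L[ℝ] B}

lemma half_polarLog_mem (hE : IsTripleSplitting H S E) {x v : B} (hx : x ∈ H) (hv : v ∈ H) :
    (1 / 2 : ℝ) • polarLog (exp x * exp v) ∈ H :=
  H.smul_mem _ (hE.polarLog_exp_mul_exp_mem hx hv)

/-- Two elements of `H` have a midpoint in `H` for the geometry of positive elements. -/
lemma exists_midpoint (hE : IsTripleSplitting H S E) {x₁ x₂ : B} (h₁ : x₁ ∈ H) (h₂ : x₂ ∈ H) :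
    ∃ x ∈ H, ∃ v : B, ∀ N : Seminorm ℝ B, IsConjExpansive N →
      N ((2 : ℝ) • (x₂ - x₁)) ≤ N v ∧ ∀ g : B, IsUnit g → ∃ w : B,
        N (polarLog (exp (-x) * g)) = N w ∧
        N (w + (1 / 2 : ℝ) • v) ≤ N (polarLog (exp (-x₁) * g)) ∧
        N (w - (1 / 2 : ℝ) • v) ≤ N (polarLog (exp (-x₂) * g)) := by
  have hs₁ := hE.isSelfAdjoint_left _ h₁
  have hs₂ := hE.isSelfAdjoint_left _ h₂
  set v := polarLog (exp (-x₁) * exp x₂) with hv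
  have hvH : v ∈ H := hE.polarLog_exp_mul_exp_mem (H.neg_mem h₁) h₂
  have hvs : IsSelfAdjoint v := isSelfAdjoint_polarLog _
  obtain ⟨u, hu, e⟩ := exists_eq_exp_mul_unitary ((isUnit_exp' (-x₁)).mul (isUnit_exp' x₂))
  rw [← hv] at e
  -- Since e^{-x₁} e^{x₂} = e^{v/2} u = e^c e^c u, the midpoint is represented by e^{x₁} e^c.
  set c := (1 / 4 : ℝ) • v with hc
  have hcs : IsSelfAdjoint c := (IsSelfAdjoint.all (1 / 4 : ℝ)).smul hvs
  have hcc : exp ((1 / 2 : ℝ) • v) = exp c * exp c := by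
    rw [hc, exp_smul_mul_exp_smul]; norm_num
  have hpc : polarLog (exp c) = (1 / 2 : ℝ) • v := by
    rw [polarLog_exp hcs, hc, smul_smul]; norm_num
  have hpc' : polarLog (exp (-c)) = -((1 / 2 : ℝ) • v) := by
    rw [polarLog_exp hcs.neg, hc, smul_neg, smul_smul]; norm_num
  obtain ⟨u', hu', e'⟩ := exists_eq_exp_mul_unitary ((isUnit_exp' x₁).mul (isUnit_exp' c))
  set x := (1 / 2 : ℝ) • polarLog (exp x₁ * exp c) with hx
  refine ⟨x, hE.half_polarLog_mem h₁ (H.smul_mem _ hvH), v, fun N hN => ⟨?_, fun g hg => ?_⟩⟩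
  · have h := hN.polarLog_mul_sub_le (isUnit_exp' x₁) ((isUnit_exp' (-x₁)).mul (isUnit_exp' x₂))
    rw [← mul_assoc, exp_mul_exp_neg, one_mul, polarLog_exp hs₁, polarLog_exp hs₂,
      ← smul_sub] at h
    exact h
  · have hk : IsUnit (exp (-c) * exp (-x₁) * g) :=
      ((isUnit_exp' _).mul (isUnit_exp' _)).mul hg
    -- This is g seen from the midpoint: up to unitaries on the left, the three points see g as k,
    -- e^c k and e^{-c} k.
    set k := exp (-c) * exp (-x₁) * g with hkdef
    have hxg : exp (-x) * g = u' * k := by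
      have h1 := exp_neg_mul_of_eq e'
      rw [hkdef, ← h1]
      calc exp (-x) * g = exp (-x) * exp x₁ * (exp c * exp (-c)) * exp (-x₁) * g := by
            rw [exp_mul_exp_neg, mul_one, mul_assoc (exp (-x)), exp_mul_exp_neg, mul_one]
        _ = _ := by simp only [mul_assoc]
    have hx₁g : exp (-x₁) * g = exp c * k := by
      rw [hkdef, ← mul_assoc, ← mul_assoc, exp_mul_exp_neg, one_mul]
    have hx₂g : exp (-x₂) * g = star u * (exp (-c) * k) := by
      have h1 : exp x₂ = exp x₁ * (exp c * exp c) * u := by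
        rw [← hcc, mul_assoc, ← e, ← mul_assoc, exp_mul_exp_neg, one_mul]
      have h2 : star u * (exp (-c) * exp (-c) * exp (-x₁)) * exp x₂ = 1 := by
        rw [h1]
        calc star u * (exp (-c) * exp (-c) * exp (-x₁)) * (exp x₁ * (exp c * exp c) * u)
            = star u * (exp (-c) * (exp (-c) * (exp (-x₁) * exp x₁) * exp c) * exp c) * u := by
              simp only [mul_assoc]
          _ = 1 := by
              rw [exp_neg_mul_exp, mul_one, exp_neg_mul_exp, mul_one, exp_neg_mul_exp, mul_one,
                Unitary.star_mul_self_of_mem hu]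
      have h3 : exp (-x₂) = star u * (exp (-c) * exp (-c) * exp (-x₁)) := by
        calc exp (-x₂) = star u * (exp (-c) * exp (-c) * exp (-x₁)) * exp x₂ * exp (-x₂) := by
              rw [h2, one_mul]
          _ = _ := by rw [mul_assoc _ (exp x₂), exp_mul_exp_neg, mul_one]
      rw [h3, hkdef]; simp only [mul_assoc]
    refine ⟨polarLog k, ?_, ?_, ?_⟩
    · rw [hxg, hN.polarLog_unitary_mul hk hu']
    · have h := hN.polarLog_mul_sub_le (isUnit_exp' (-c)) ((isUnit_exp' c).mul hk)
      rwa [← mul_assoc, exp_neg_mul_exp, one_mul, hpc', sub_neg_eq_add, ← hx₁g] at h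
    · have h := hN.polarLog_mul_sub_le (isUnit_exp' c) ((isUnit_exp' (-c)).mul hk)
      rw [← mul_assoc, exp_mul_exp_neg, one_mul, hpc] at h
      rwa [hx₂g, hN.polarLog_unitary_mul ((isUnit_exp' (-c)).mul hk) (Unitary.star_mem hu)]

variable {τ : B →ₗ[ℂ] ℂ}

lemma seminorm_sub_sq (hτ : IsFaithfulTrace τ) (hE : IsTripleSplitting H S E)
    (horth : ∀ y ∈ S, ∀ x ∈ H, τ (y * x) = 0) {x y : B} (hx : x ∈ H) (hy : y ∈ S) :
    hτ.seminorm (y - x) ^ 2 = hτ.seminorm y ^ 2 + hτ.seminorm x ^ 2 := by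
  rw [sub_eq_add_neg, hτ.seminorm_add_sq, map_neg_eq_map, (hE.isSelfAdjoint_right y hy).star_eq,
    mul_neg, map_neg, horth y hy x hx]
  simp

/-- Pythagoras in nonpositive curvature. Seen from e^x, the logarithms of g and e^{x'} are
orthogonal legs, and the flat hypotenuse is at most the true distance from e^{x'} to g. -/
lemma seminorm_sq_add_le (hτ : IsFaithfulTrace τ) (hE : IsTripleSplitting H S E)
    (horth : ∀ y ∈ S, ∀ x ∈ H, τ (y * x) = 0) {g x x' : B} (hg : IsUnit g) (hx : x ∈ H)
    (hx' : x' ∈ H) (hy : polarLog (exp (-x) * g) ∈ S) :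
    hτ.seminorm (polarLog (exp (-x) * g)) ^ 2
      + hτ.seminorm (polarLog (exp (-x) * exp x')) ^ 2
      ≤ hτ.seminorm (polarLog (exp (-x') * g)) ^ 2 := by
  have h := hτ.isConjExpansive.polarLog_mul_sub_le ((isUnit_exp' (-x)).mul (isUnit_exp' x'))
    ((isUnit_exp' (-x')).mul hg)
  have e : exp (-x) * exp x' * (exp (-x') * g) = exp (-x) * g := by
    calc exp (-x) * exp x' * (exp (-x') * g) = exp (-x) * (exp x' * exp (-x')) * g := by
          simp only [mul_assoc]
      _ = _ := by rw [exp_mul_exp_neg, mul_one]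
  rw [e] at h
  rw [← seminorm_sub_sq hτ hE horth (hE.polarLog_exp_mul_exp_mem (H.neg_mem hx) hx') hy]
  exact pow_le_pow_left₀ (apply_nonneg _ _) h 2

lemma polarLog_exp_neg_mul_of_eq {g x y u : B} (hy : IsSelfAdjoint y) (hu : u ∈ unitary B)
    (h : g = exp x * exp y * u) : polarLog (exp (-x) * g) = (2 : ℝ) • y := by
  rw [h, ← mul_assoc, ← mul_assoc, exp_neg_mul_exp, one_mul, polarLog_mul_unitary _ hu,
    polarLog_exp hy]

/-- Both x and x' are feet of perpendiculars, so adding the two Pythagorean inequalities leaves no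
distance between them. -/
lemma decomposition_unique (hτ : IsFaithfulTrace τ) (hE : IsTripleSplitting H S E)
    (horth : ∀ y ∈ S, ∀ x ∈ H, τ (y * x) = 0) {g x x' y y' u u' : B} (hg : IsUnit g)
    (hx : x ∈ H) (hx' : x' ∈ H) (hy : y ∈ S) (hy' : y' ∈ S) (hu : u ∈ unitary B)
    (hu' : u' ∈ unitary B) (h : g = exp x * exp y * u) (h' : g = exp x' * exp y' * u') :
    x = x' ∧ y = y' ∧ u = u' := by
  have hxs := hE.isSelfAdjoint_left x hx
  have hxs' := hE.isSelfAdjoint_left x' hx'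
  have e := polarLog_exp_neg_mul_of_eq (hE.isSelfAdjoint_right y hy) hu h
  have e' := polarLog_exp_neg_mul_of_eq (hE.isSelfAdjoint_right y' hy') hu' h'
  have h1 := seminorm_sq_add_le hτ hE horth hg hx hx' (by rw [e]; exact S.smul_mem _ hy)
  have h2 := seminorm_sq_add_le hτ hE horth hg hx' hx (by rw [e']; exact S.smul_mem _ hy')
  have h3 : hτ.seminorm (polarLog (exp (-x) * exp x')) = 0 := by
    have := sq_nonneg (hτ.seminorm (polarLog (exp (-x') * exp x)))
    have h4 : hτ.seminorm (polarLog (exp (-x) * exp x')) ^ 2 ≤ 0 := by linarith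
    exact pow_eq_zero_iff (two_ne_zero) |>.mp (le_antisymm h4 (sq_nonneg _))
  have h4 := hτ.eq_zero_of_seminorm_eq_zero h3
  have h5 := exp_polarLog ((isUnit_exp' (-x)).mul (isUnit_exp' x'))
  rw [h4, exp_zero, star_mul, hxs'.exp.star_eq, hxs.neg.exp.star_eq] at h5
  have h6 : exp x * exp x = exp x' * exp x' := by
    calc exp x * exp x = exp x * 1 * exp x := by rw [mul_one]
      _ = (exp x * exp (-x)) * (exp x' * exp x') * (exp (-x) * exp x) := by
          rw [h5]; simp only [mul_assoc]
      _ = _ := by rw [exp_mul_exp_neg, exp_neg_mul_exp, one_mul, mul_one]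
  have h7 : (2 : ℝ) • x = (2 : ℝ) • x' := by
    refine exp_injOn_isSelfAdjoint ((IsSelfAdjoint.all (2 : ℝ)).smul hxs)
      ((IsSelfAdjoint.all (2 : ℝ)).smul hxs') ?_
    rw [two_smul, two_smul, exp_add_of_commute_real (Commute.refl x),
      exp_add_of_commute_real (Commute.refl x'), h6]
  have hxx : x = x' := smul_right_injective B (two_ne_zero (α := ℝ)) h7
  subst hxx
  have hyy : y = y' := smul_right_injective B (two_ne_zero (α := ℝ)) (e.symm.trans e')
  subst hyy
  exact ⟨rfl, rfl, ((isUnit_exp' x).mul (isUnit_exp' y)).mul_left_cancel (h.symm.trans h')⟩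

lemma norm_polarLog_exp {x : B} (hx : IsSelfAdjoint x) : ‖polarLog (exp x)‖ = 2 * ‖x‖ := by
  rw [polarLog_exp hx, norm_smul]; norm_num

/-- On operator norm balls the curved distance is controlled by the flat one, so trace norm limits
can be taken in the distance function. The exponent 8R is 4R for inverting exp near w plus R + 2R +
R for conjugation and Duhamel. -/
lemma seminorm_polarLog_exp_neg_mul_exp_le (hτ : IsFaithfulTrace τ) {x y : B} {R : ℝ}
    (hx : IsSelfAdjoint x) (hy : IsSelfAdjoint y) (hxR : ‖x‖ ≤ R) (hyR : ‖y‖ ≤ R) :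
    hτ.seminorm (polarLog (exp (-x) * exp y))
      ≤ 2 * Real.exp (8 * R) * hτ.seminorm (y - x) := by
  set w := polarLog (exp (-x) * exp y) with hw
  have hwM : ‖w‖ ≤ 4 * R := by
    have h := isConjExpansive_norm.polarLog_mul_le (isUnit_exp' (-x)) (isUnit_exp' y)
    have h' : ‖w‖ ≤ ‖polarLog (exp (-x))‖ + ‖polarLog (exp y)‖ := h
    rw [norm_polarLog_exp hx.neg, norm_polarLog_exp hy, norm_neg] at h'
    linarith
  have h1 := hτ.seminorm_le_exp_sub_one (isSelfAdjoint_polarLog _) hwM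
  have h2 : exp w - 1 = exp (-x) * (exp ((2 : ℝ) • y) - exp ((2 : ℝ) • x)) * exp (-x) := by
    rw [hw, exp_polarLog ((isUnit_exp' (-x)).mul (isUnit_exp' y)), star_mul, hy.exp.star_eq,
      hx.neg.exp.star_eq, two_smul, two_smul, exp_add_of_commute_real (Commute.refl x),
      exp_add_of_commute_real (Commute.refl y), mul_sub, sub_mul]
    congr 1
    · simp only [mul_assoc]
    · rw [← mul_assoc, exp_neg_mul_exp, one_mul, exp_mul_exp_neg]
  have hR : ‖exp (-x)‖ ≤ Real.exp R := by
    refine (norm_exp_le_exp_norm_of_isSelfAdjoint hx.neg).trans ?_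
    rwa [norm_neg, Real.exp_le_exp]
  have h3 : hτ.seminorm (exp ((2 : ℝ) • y) - exp ((2 : ℝ) • x))
      ≤ Real.exp (2 * R) * (2 * hτ.seminorm (y - x)) := by
    have h := hτ.seminorm_exp_sub_exp_le (M := 2 * R) ((IsSelfAdjoint.all (2 : ℝ)).smul hy)
      ((IsSelfAdjoint.all (2 : ℝ)).smul hx) (by rw [norm_smul]; norm_num; exact hyR)
      (by rw [norm_smul]; norm_num; exact hxR)
    rwa [← smul_sub, map_smul_eq_mul, Real.norm_of_nonneg (by norm_num)] at h
  have hN := apply_nonneg hτ.seminorm (y - x)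
  have h4 : hτ.seminorm (exp w - 1)
      ≤ Real.exp R * (Real.exp (2 * R) * (2 * hτ.seminorm (y - x))) * Real.exp R := by
    rw [h2]
    refine (hτ.seminorm_mul_le_right _ _).trans ?_
    refine mul_le_mul ((hτ.seminorm_mul_le_left _ _).trans ?_) hR (norm_nonneg _) (by positivity)
    exact mul_le_mul hR h3 (apply_nonneg _ _) (Real.exp_nonneg _)
  have h5 : Real.exp (8 * R)
      = Real.exp (4 * R) * (Real.exp R * Real.exp (2 * R) * Real.exp R) := by
    rw [← Real.exp_add, ← Real.exp_add, ← Real.exp_add]; ring_nf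
  refine h1.trans ((mul_le_mul_of_nonneg_left h4 (Real.exp_nonneg _)).trans_eq ?_)
  rw [h5]; ring

/-- A minimiser of the distance over a ball of `H` which is large enough is a critical point. -/
lemma map_polarLog_eq_zero_of_minimiser (hτ : IsFaithfulTrace τ) (hE : IsTripleSplitting H S E)
    (horth : ∀ y ∈ S, ∀ x ∈ H, τ (y * x) = 0) {g x : B} {R : ℝ} (hg : IsUnit g) (hx : x ∈ H)
    (hxR : ‖x‖ ≤ R) (hR : ‖E‖ * ‖polarLog g‖ < 2 * R)
    (hmin : ∀ x' ∈ H, ‖x'‖ ≤ R → hτ.seminorm (polarLog (exp (-x) * g))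
      ≤ hτ.seminorm (polarLog (exp (-x') * g))) :
    E (polarLog (exp (-x) * g)) = 0 := by
  have hxs := hE.isSelfAdjoint_left x hx
  have hxg : IsUnit (exp (-x) * g) := (isUnit_exp' _).mul hg
  set w := polarLog (exp (-x) * g) with hw
  have hws : IsSelfAdjoint w := isSelfAdjoint_polarLog _
  set n := E w with hn
  have hnH : n ∈ H := hE.map_mem w hws
  have hns := hE.isSelfAdjoint_left n hnH
  by_contra hne
  have hnpos : 0 < hτ.seminorm n :=
    lt_of_le_of_ne (apply_nonneg _ _) fun h => hne (hτ.eq_zero_of_seminorm_eq_zero h.symm)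
  -- Removing the nonzero H-component strictly shortens w, so moving x in the direction n decreases
  -- the distance to first order.
  have hlt : hτ.seminorm (w - n) < hτ.seminorm w := by
    have h1 := seminorm_sub_sq hτ hE horth (H.neg_mem hnH) (hE.sub_mem w hws)
    rw [sub_neg_eq_add, sub_add_cancel, map_neg_eq_map] at h1
    refine lt_of_pow_lt_pow_left₀ 2 (apply_nonneg _ _) ?_
    have := pow_pos hnpos 2
    linarith
  -- The direction points into the ball even when ‖x‖ = R: 2x + n = E(w + 2x), and ‖w + 2x‖ ≤
  -- ‖polarLog g‖ by the metric increasing property.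
  have hlt' : ‖(2 : ℝ) • x + n‖ < 2 * R := by
    have h1 : (2 : ℝ) • x + n = E (w - (2 : ℝ) • (-x)) := by
      rw [map_sub, map_smul, map_neg, hE.map_of_mem hx, smul_neg, sub_neg_eq_add, add_comm]
    have h2 : ‖w - (2 : ℝ) • (-x)‖ ≤ ‖polarLog g‖ := by
      have := isConjExpansive_norm.polarLog_mul_sub_le (isUnit_exp' (-x)) hg
      rw [polarLog_exp hxs.neg] at this
      exact this
    rw [h1]
    exact ((E.le_opNorm _).trans (mul_le_mul_of_nonneg_left h2 (norm_nonneg _))).trans_lt hR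
  have hnh : (1 / 2 : ℝ) • n ∈ H := H.smul_mem _ hnH
  have hnhs := hE.isSelfAdjoint_left _ hnh
  have hwhs : IsSelfAdjoint ((1 / 2 : ℝ) • w) := (IsSelfAdjoint.all (1 / 2 : ℝ)).smul hws
  have hp0 : polarLog (1 : B) = 0 := polarLog_eq_of_exp_eq (.zero B) (by simp)
  have hd1 := hasDerivAt_polarLog_exp_mul_exp_zero hxs hnhs
  have hd2 := hasDerivAt_polarLog_exp_mul_exp_zero hnhs.neg hwhs
  have e1 : (2 : ℝ) • (x + (1 / 2 : ℝ) • n) = (2 : ℝ) • x + n := by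
    rw [smul_add, smul_smul]; norm_num
  have e2 : (2 : ℝ) • (-((1 / 2 : ℝ) • n) + (1 / 2 : ℝ) • w) = w - n := by
    rw [smul_add, smul_neg, smul_smul, smul_smul]; norm_num; abel
  rw [e1] at hd1
  rw [e2] at hd2
  obtain ⟨c, hc1, hc2⟩ := exists_between hlt
  have hev1 := eventually_seminorm_le_mul (normSeminorm ℝ B) continuous_norm hd1
    (by simp [hp0]) hlt'
  have hev2 := eventually_seminorm_le_mul hτ.seminorm hτ.continuous_seminorm hd2
    (by simp [hp0]) hc1
  have hev3 : ∀ᶠ t in 𝓝[>] (0 : ℝ), t < 1 :=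
    (gt_mem_nhds (by norm_num : (0 : ℝ) < 1)).filter_mono nhdsWithin_le_nhds
  obtain ⟨t, ⟨⟨h1, h2⟩, h3⟩, h4⟩ :=
    (((hev1.and hev2).and hev3).and (self_mem_nhdsWithin (a := (0 : ℝ)) (s := Set.Ioi 0))).exists
  have ht0 : 0 < t := h4
  have h1' : ‖polarLog (exp (t • x) * exp (t • (1 / 2 : ℝ) • n))‖ ≤ 2 * R * t := h1
  have htn : t • (1 / 2 : ℝ) • n ∈ H := H.smul_mem _ hnh
  set p := t • (1 / 2 : ℝ) • n with hp
  obtain ⟨u, hu, e⟩ := exists_eq_exp_mul_unitary ((isUnit_exp' x).mul (isUnit_exp' p))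
  have hxt : (1 / 2 : ℝ) • polarLog (exp x * exp p) ∈ H := hE.half_polarLog_mem hx htn
  set x' := (1 / 2 : ℝ) • polarLog (exp x * exp p) with hx'
  have hnorm : ‖x'‖ ≤ R := by
    -- The first factor contributes at most 2(1 - t)R, the second at most 2tR by the first
    -- variation.
    have hsplit : exp x * exp p = exp ((1 - t) • x) * (exp (t • x) * exp p) := by
      rw [← mul_assoc, exp_smul_mul_exp_smul]; norm_num
    have h5 : ‖polarLog (exp x * exp p)‖ ≤ ‖polarLog (exp ((1 - t) • x))‖
        + ‖polarLog (exp (t • x) * exp p)‖ := by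
      rw [hsplit]
      exact isConjExpansive_norm.polarLog_mul_le (isUnit_exp' _)
        ((isUnit_exp' _).mul (isUnit_exp' _))
    rw [norm_polarLog_exp ((IsSelfAdjoint.all (1 - t)).smul hxs), norm_smul,
      Real.norm_of_nonneg (by linarith)] at h5
    rw [hx', norm_smul]
    norm_num
    nlinarith
  have hcon := hmin x' hxt hnorm
  have hxg' : hτ.seminorm (polarLog (exp (-x') * g))
      = hτ.seminorm (polarLog (exp (-p) * exp ((1 / 2 : ℝ) • w))) := by
    obtain ⟨u₂, hu₂, e₂⟩ := exists_eq_exp_mul_unitary hxg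
    rw [← hw] at e₂
    have h6 := exp_neg_mul_of_eq e
    have h7 : exp (-x') * g = u * (exp (-p) * exp ((1 / 2 : ℝ) • w) * u₂) := by
      rw [mul_assoc (exp (-p)), ← e₂, ← h6]
      calc exp (-x') * g = exp (-x') * exp x * (exp p * exp (-p)) * exp (-x) * g := by
            rw [exp_mul_exp_neg, mul_one, mul_assoc (exp (-x')), exp_mul_exp_neg, mul_one]
        _ = _ := by simp only [mul_assoc]
    rw [h7, hτ.isConjExpansive.polarLog_unitary_mul _ hu, polarLog_mul_unitary _ hu₂]
    exact ((isUnit_exp' _).mul (isUnit_exp' _)).mul (Unitary.toUnits ⟨u₂, hu₂⟩).isUnit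
  -- The same splitting bounds the new distance by ct + (1 - t)N(w) with c < N(w), contradicting
  -- minimality.
  have hsplit : exp (-p) * exp ((1 / 2 : ℝ) • w)
      = (exp (t • -((1 / 2 : ℝ) • n)) * exp (t • (1 / 2 : ℝ) • w))
        * exp ((1 - t) • (1 / 2 : ℝ) • w) := by
    rw [mul_assoc, exp_smul_mul_exp_smul, smul_neg, ← hp]; norm_num
  have h8 := hτ.isConjExpansive.polarLog_mul_le
    ((isUnit_exp' (t • -((1 / 2 : ℝ) • n))).mul (isUnit_exp' (t • (1 / 2 : ℝ) • w)))
    (isUnit_exp' ((1 - t) • (1 / 2 : ℝ) • w))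
  have h9 : (1 - t) • (1 / 2 : ℝ) • w = (1 / 2 : ℝ) • (1 - t) • w := smul_comm _ _ _
  rw [← hsplit, h9, polarLog_exp_half ((IsSelfAdjoint.all (1 - t)).smul hws), map_smul_eq_mul,
    Real.norm_of_nonneg (by linarith)] at h8
  rw [hxg'] at hcon
  nlinarith

/-- The bounded selfadjoint subsets of `B` are complete for the seminorm of the trace. -/
def _root_.IsFaithfulTrace.IsBallComplete (hτ : IsFaithfulTrace τ) : Prop :=
  ∀ (x : ℕ → B) (R : ℝ), (∀ n, IsSelfAdjoint (x n)) → (∀ n, ‖x n‖ ≤ R) →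
    (∀ ε > 0, ∃ k, ∀ m ≥ k, ∀ n ≥ k, hτ.seminorm (x m - x n) < ε) →
    ∃ y, IsSelfAdjoint y ∧ ‖y‖ ≤ R ∧ Tendsto (fun n => hτ.seminorm (x n - y)) atTop (𝓝 0)

/-- y - E y is orthogonal to x n - E y, so its trace norm is at most that of x n - y. Norm
closedness of H would not suffice here. -/
lemma mem_of_tendsto_seminorm (hτ : IsFaithfulTrace τ) (hE : IsTripleSplitting H S E)
    (horth : ∀ y ∈ S, ∀ x ∈ H, τ (y * x) = 0) {x : ℕ → B} {y : B} (hx : ∀ n, x n ∈ H)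
    (hy : IsSelfAdjoint y) (h : Tendsto (fun n => hτ.seminorm (x n - y)) atTop (𝓝 0)) :
    y ∈ H := by
  have hs := hE.sub_mem y hy
  have h1 : ∀ n, hτ.seminorm (y - E y) ^ 2 ≤ hτ.seminorm (x n - y) ^ 2 := by
    intro n
    have h2 := seminorm_sub_sq hτ hE horth (H.sub_mem (hx n) (hE.map_mem y hy)) hs
    have e : y - E y - (x n - E y) = -(x n - y) := by abel
    rw [e, map_neg_eq_map] at h2
    have := sq_nonneg (hτ.seminorm (x n - E y))
    linarith
  have h2 := ge_of_tendsto (h.pow 2) (Eventually.of_forall h1)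
  have h3 : hτ.seminorm (y - E y) = 0 := by
    rw [zero_pow two_ne_zero] at h2
    exact pow_eq_zero_iff two_ne_zero |>.mp (le_antisymm h2 (sq_nonneg _))
  rw [sub_eq_zero.mp (hτ.eq_zero_of_seminorm_eq_zero h3)]
  exact hE.map_mem y hy

lemma exists_minimiser (hτ : IsFaithfulTrace τ) (hE : IsTripleSplitting H S E)
    (horth : ∀ y ∈ S, ∀ x ∈ H, τ (y * x) = 0) (hcomp : hτ.IsBallComplete) {g : B} {R : ℝ}
    (hg : IsUnit g) (hR : 0 ≤ R) :
    ∃ x ∈ H, ‖x‖ ≤ R ∧ ∀ x' ∈ H, ‖x'‖ ≤ R → hτ.seminorm (polarLog (exp (-x) * g))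
      ≤ hτ.seminorm (polarLog (exp (-x') * g)) := by
  let f : B → ℝ := fun x => hτ.seminorm (polarLog (exp (-x) * g))
  let K : Set B := {x | x ∈ H ∧ ‖x‖ ≤ R}
  have hKne : (f '' K).Nonempty := ⟨f 0, 0, ⟨H.zero_mem, by simpa⟩, rfl⟩
  have hbdd : BddBelow (f '' K) := ⟨0, by rintro _ ⟨x, -, rfl⟩; exact apply_nonneg _ _⟩
  set I := sInf (f '' K) with hI
  have hIle {x : B} (hx : x ∈ K) : I ≤ f x := csInf_le hbdd ⟨x, hx, rfl⟩
  have hI0 : 0 ≤ I := le_csInf hKne (by rintro _ ⟨x, -, rfl⟩; exact apply_nonneg _ _)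
  -- The semiparallelogram law: almost minimal points are close to each other because their midpoint
  -- is no better than the infimum.
  have hmid {x₁ x₂ : B} (h₁ : x₁ ∈ K) (h₂ : x₂ ∈ K) :
      2 * hτ.seminorm (x₂ - x₁) ^ 2 ≤ f x₁ ^ 2 + f x₂ ^ 2 - 2 * I ^ 2 := by
    obtain ⟨x, hx, v, hv⟩ := hE.exists_midpoint h₁.1 h₂.1
    have hxK : x ∈ K := by
      refine ⟨hx, ?_⟩
      -- The same midpoint serves for the operator norm; taking g = 1 shows that it stays in the
      -- ball.
      obtain ⟨-, h⟩ := hv _ isConjExpansive_norm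
      obtain ⟨w, ha, hb, hc⟩ := h 1 isUnit_one
      have ha' : ‖polarLog (exp (-x) * 1)‖ = ‖w‖ := ha
      have hb' : ‖w + (1 / 2 : ℝ) • v‖ ≤ ‖polarLog (exp (-x₁) * 1)‖ := hb
      have hc' : ‖w - (1 / 2 : ℝ) • v‖ ≤ ‖polarLog (exp (-x₂) * 1)‖ := hc
      rw [mul_one, norm_polarLog_exp (hE.isSelfAdjoint_left _ hx).neg, norm_neg] at ha'
      rw [mul_one, norm_polarLog_exp (hE.isSelfAdjoint_left _ h₁.1).neg, norm_neg] at hb'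
      rw [mul_one, norm_polarLog_exp (hE.isSelfAdjoint_left _ h₂.1).neg, norm_neg] at hc'
      have h2w : ‖(2 : ℝ) • w‖ ≤ ‖w + (1 / 2 : ℝ) • v‖ + ‖w - (1 / 2 : ℝ) • v‖ := by
        have : (2 : ℝ) • w = (w + (1 / 2 : ℝ) • v) + (w - (1 / 2 : ℝ) • v) := by
          rw [two_smul]; abel
        rw [this]
        exact norm_add_le _ _
      rw [norm_smul] at h2w
      norm_num at h2w
      linarith [h₁.2, h₂.2]
    obtain ⟨hv1, h⟩ := hv _ hτ.isConjExpansive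
    obtain ⟨w, ha, hb, hc⟩ := h g hg
    have h5 := hτ.seminorm_add_sq_add_sub_sq w ((1 / 2 : ℝ) • v)
    have h6 : f x = hτ.seminorm w := ha
    have h7 : hτ.seminorm (x₂ - x₁) ≤ hτ.seminorm ((1 / 2 : ℝ) • v) := by
      rw [map_smul_eq_mul] at hv1 ⊢
      norm_num at hv1 ⊢
      linarith
    have h8 := pow_le_pow_left₀ (apply_nonneg _ _) hb 2
    have h9 := pow_le_pow_left₀ (apply_nonneg _ _) hc 2
    have h10 := pow_le_pow_left₀ (apply_nonneg _ _) h7 2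
    have h11 := pow_le_pow_left₀ hI0 (hIle hxK) 2
    rw [h6] at h11
    change _ ≤ hτ.seminorm (polarLog (exp (-x₁) * g)) ^ 2
      + hτ.seminorm (polarLog (exp (-x₂) * g)) ^ 2 - 2 * I ^ 2
    linarith
  have hseq (n : ℕ) : ∃ x ∈ K, f x < I + 1 / ((n : ℝ) + 1) := by
    obtain ⟨_, ⟨x, hx, rfl⟩, h⟩ := exists_lt_of_csInf_lt hKne
      (lt_add_of_pos_right I (by positivity : (0 : ℝ) < 1 / ((n : ℝ) + 1)))
    exact ⟨x, hx, h⟩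
  choose x hxK hxf using hseq
  have hlim : Tendsto (fun n => f (x n)) atTop (𝓝 I) := by
    refine tendsto_of_tendsto_of_tendsto_of_le_of_le tendsto_const_nhds ?_
      (fun n => hIle (hxK n)) (fun n => (hxf n).le)
    simpa using tendsto_one_div_add_atTop_nhds_zero_nat.const_add I
  have hcau : ∀ ε > 0, ∃ k, ∀ m ≥ k, ∀ n ≥ k, hτ.seminorm (x m - x n) < ε := by
    intro ε hε
    have h1 : ∀ᶠ n in atTop, f (x n) ^ 2 < I ^ 2 + ε ^ 2 / 2 :=
      (hlim.pow 2).eventually_lt_const (by have := pow_pos hε 2; linarith)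
    obtain ⟨k, hk⟩ := eventually_atTop.mp h1
    refine ⟨k, fun m hm n hn => lt_of_pow_lt_pow_left₀ 2 hε.le ?_⟩
    have h2 := hmid (hxK n) (hxK m)
    have h3 := hk m hm
    have h4 := hk n hn
    have := pow_pos hε 2
    linarith
  obtain ⟨y, hys, hyR, hy⟩ := hcomp x R (fun n => hE.isSelfAdjoint_left _ (hxK n).1)
    (fun n => (hxK n).2) hcau
  have hyH : y ∈ H := mem_of_tendsto_seminorm hτ hE horth (fun n => (hxK n).1) hys hy
  refine ⟨y, hyH, hyR, fun x' hx' hx'R => ?_⟩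
  refine le_trans ?_ (hIle ⟨hx', hx'R⟩)
  have hup (n : ℕ) : hτ.seminorm (polarLog (exp (-y) * g))
      ≤ 2 * Real.exp (8 * R) * hτ.seminorm (x n - y) + f (x n) := by
    have e : exp (-y) * g = exp (-y) * exp (x n) * (exp (-(x n)) * g) := by
      calc exp (-y) * g = exp (-y) * (exp (x n) * exp (-(x n))) * g := by
            rw [exp_mul_exp_neg, mul_one]
        _ = _ := by simp only [mul_assoc]
    rw [e]
    refine (hτ.isConjExpansive.polarLog_mul_le ((isUnit_exp' _).mul (isUnit_exp' _))
      ((isUnit_exp' _).mul hg)).trans ?_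
    exact add_le_add (seminorm_polarLog_exp_neg_mul_exp_le hτ hys
      (hE.isSelfAdjoint_left _ (hxK n).1) hyR (hxK n).2) le_rfl
  have hl2 := (hy.const_mul (2 * Real.exp (8 * R))).add hlim
  rw [mul_zero, zero_add] at hl2
  exact ge_of_tendsto hl2 (Eventually.of_forall hup)

theorem exists_decomposition (hτ : IsFaithfulTrace τ) (hE : IsTripleSplitting H S E)
    (horth : ∀ y ∈ S, ∀ x ∈ H, τ (y * x) = 0) (hcomp : hτ.IsBallComplete) {g : B}
    (hg : IsUnit g) : ∃ x ∈ H, ∃ y ∈ S, ∃ u ∈ unitary B, g = exp x * exp y * u := by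
  have hpos : 0 ≤ ‖E‖ * ‖polarLog g‖ := by positivity
  -- Any R with 2R > ‖E‖ ‖polarLog g‖ makes the minimiser critical.
  obtain ⟨x, hx, hxR, hmin⟩ := exists_minimiser hτ hE horth hcomp hg
    (R := ‖E‖ * ‖polarLog g‖ + 1) (by linarith)
  have h0 := map_polarLog_eq_zero_of_minimiser hτ hE horth hg hx hxR (by linarith) hmin
  have hS := hE.sub_mem _ (isSelfAdjoint_polarLog (exp (-x) * g))
  rw [h0, sub_zero] at hS
  obtain ⟨u, hu, e⟩ := exists_eq_exp_mul_unitary ((isUnit_exp' (-x)).mul hg)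
  refine ⟨x, hx, _, S.smul_mem (1 / 2 : ℝ) hS, u, hu, ?_⟩
  rw [mul_assoc, ← e, ← mul_assoc, exp_mul_exp_neg, one_mul]

end IsTripleSplitting

end Decomposition

/-! ### Order and strong limits in a von Neumann algebra. -/

section VonNeumann

open NormedSpace Filter Topology

/-- a - a² = a(1 - a)a + (1 - a)a(1 - a), so no functional calculus is needed. -/
lemma mul_self_le_self_of_le_one {R : Type*} [Ring R] [PartialOrder R] [StarRing R]
    [StarOrderedRing R] {a : R} (h0 : 0 ≤ a) (h1 : a ≤ 1) : a * a ≤ a := by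
  have ha : IsSelfAdjoint a := .of_nonneg h0
  have h2 := ha.conjugate_nonneg (sub_nonneg.mpr h1)
  have h3 := ((IsSelfAdjoint.one R).sub ha).conjugate_nonneg h0
  have h4 : a * (1 - a) * a + (1 - a) * a * (1 - a) = a - a * a := by noncomm_ring
  exact sub_nonneg.mp (h4 ▸ add_nonneg h2 h3)

namespace VonNeumannAlgebra

variable {K : Type*} [NormedAddCommGroup K] [InnerProductSpace ℂ K] [CompleteSpace K]
  (A : VonNeumannAlgebra K)

lemma isClosed : IsClosed (A.toStarSubalgebra : Set (K →L[ℂ] K)) := by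
  rw [VonNeumannAlgebra.coe_toStarSubalgebra, ← A.centralizer_centralizer]
  exact Set.isClosed_centralizer _

/-- The C*-algebra structure of a von Neumann algebra. -/
@[reducible]
noncomputable def cstarAlgebra : CStarAlgebra A.toStarSubalgebra :=
  StarSubalgebra.cstarAlgebra A.toStarSubalgebra (h_closed := A.isClosed)

attribute [local instance] cstarAlgebra

variable {A}

lemma mem_of_forall_commute {T : K →L[ℂ] K}
    (h : ∀ z : K →L[ℂ] K, (∀ a ∈ A.toStarSubalgebra, Commute a z) → Commute T z) :
    T ∈ A.toStarSubalgebra := by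
  rw [← SetLike.mem_coe, coe_toStarSubalgebra, ← A.centralizer_centralizer]
  intro z hz
  exact (h z fun a ha => hz a ha).eq.symm

/-- The square root of a positive operator in A commutes with the commutant, hence lies in A; so the
Loewner order is also the intrinsic order of A. -/
instance instStarOrderedRing : StarOrderedRing A.toStarSubalgebra := by
  refine StarOrderedRing.of_nonneg_iff' ?_ ?_
  · intro x y h z
    exact add_le_add_right (α := K →L[ℂ] K) h z
  · intro x
    constructor
    · intro hx
      have hx' : (0 : K →L[ℂ] K) ≤ x := hx
      have hmem : CFC.sqrt (x : K →L[ℂ] K) ∈ A.toStarSubalgebra :=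
        mem_of_forall_commute fun z hz => (hz x x.2).cfcₙ_nnreal _
      refine ⟨⟨_, hmem⟩, Subtype.ext ?_⟩
      change (x : K →L[ℂ] K) = star (CFC.sqrt (x : K →L[ℂ] K)) * CFC.sqrt (x : K →L[ℂ] K)
      rw [(IsSelfAdjoint.of_nonneg (CFC.sqrt_nonneg _)).star_eq, CFC.sqrt_mul_sqrt_self _ hx']
    · rintro ⟨s, rfl⟩
      exact star_mul_self_nonneg (s : K →L[ℂ] K)

lemma exists_strong_limit {T : ℕ → A.toStarSubalgebra} {R : ℝ} (hR : ∀ n, ‖T n‖ ≤ R)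
    (hT : ∀ n, IsSelfAdjoint (T n))
    (h : ∀ ξ, CauchySeq fun n => (T n : K →L[ℂ] K) ξ) :
    ∃ S : A.toStarSubalgebra, IsSelfAdjoint S ∧ ‖S‖ ≤ R ∧
      ∀ ξ, Tendsto (fun n => (T n : K →L[ℂ] K) ξ) atTop (𝓝 ((S : K →L[ℂ] K) ξ)) := by
  choose f hf using fun ξ => cauchySeq_tendsto_of_complete (h ξ)
  let S : K →L[ℂ] K := continuousLinearMapOfTendsto (fun n => (T n : K →L[ℂ] K))
    (tendsto_pi_nhds.mpr hf)
  have hS : ∀ ξ, Tendsto (fun n => (T n : K →L[ℂ] K) ξ) atTop (𝓝 (S ξ)) := hf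
  have hmem : S ∈ A.toStarSubalgebra := by
    refine mem_of_forall_commute fun z hz => ?_
    ext ξ
    refine tendsto_nhds_unique (hS (z ξ)) ?_
    refine ((z.continuous.tendsto _).comp (hS ξ)).congr fun n => ?_
    exact (congrArg (fun L : K →L[ℂ] K => L ξ) (hz _ (T n).2).eq).symm
  refine ⟨⟨S, hmem⟩, ?_, ?_, hS⟩
  · refine Subtype.ext ?_
    change star S = S
    refine ContinuousLinearMap.isSelfAdjoint_iff_isSymmetric.mpr fun ξ η => ?_
    refine tendsto_nhds_unique ((hS ξ).inner tendsto_const_nhds)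
      ((tendsto_const_nhds.inner (hS η)).congr fun n => ?_)
    have h1 : IsSelfAdjoint (T n : K →L[ℂ] K) := congrArg Subtype.val (hT n)
    exact (ContinuousLinearMap.isSelfAdjoint_iff_isSymmetric.mp h1 ξ η).symm
  · refine S.opNorm_le_bound ((norm_nonneg _).trans (hR 0)) fun ξ => ?_
    refine le_of_tendsto (hS ξ).norm (.of_forall fun n => ?_)
    exact ((T n : K →L[ℂ] K).le_opNorm ξ).trans
      (mul_le_mul_of_nonneg_right (hR n) (norm_nonneg ξ))

lemma re_inner_le {S T : A.toStarSubalgebra} (h : S ≤ T) (ξ : K) :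
    (inner ℂ ((S : K →L[ℂ] K) ξ) ξ).re ≤ (inner ℂ ((T : K →L[ℂ] K) ξ) ξ).re := by
  have h1 : ((T : K →L[ℂ] K) - S).IsPositive := (ContinuousLinearMap.le_def _ _).mp h
  have h2 := h1.re_inner_nonneg_left ξ
  rw [sub_apply, inner_sub_left] at h2
  simpa using h2

lemma le_of_re_inner_le {S T : A.toStarSubalgebra} (hS : IsSelfAdjoint S) (hT : IsSelfAdjoint T)
    (h : ∀ ξ, (inner ℂ ((S : K →L[ℂ] K) ξ) ξ).re ≤ (inner ℂ ((T : K →L[ℂ] K) ξ) ξ).re) :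
    S ≤ T := by
  change (S : K →L[ℂ] K) ≤ T
  rw [ContinuousLinearMap.le_def, ContinuousLinearMap.isPositive_def]
  refine ⟨ContinuousLinearMap.isSelfAdjoint_iff_isSymmetric.mp
    (congrArg Subtype.val (hT.sub hS)), fun ξ => ?_⟩
  rw [ContinuousLinearMap.reApplyInnerSelf_apply, sub_apply, inner_sub_left]
  simpa using h ξ

lemma norm_apply_sq_le {D : A.toStarSubalgebra} (h0 : 0 ≤ D) (h1 : D ≤ 1) (ξ : K) :
    ‖(D : K →L[ℂ] K) ξ‖ ^ 2 ≤ (inner ℂ ((D : K →L[ℂ] K) ξ) ξ).re := by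
  have h2 := re_inner_le (mul_self_le_self_of_le_one h0 h1) ξ
  refine le_trans (le_of_eq ?_) h2
  have h3 : IsSelfAdjoint (D : K →L[ℂ] K) := congrArg Subtype.val (IsSelfAdjoint.of_nonneg h0)
  have h4 := ContinuousLinearMap.isSelfAdjoint_iff_isSymmetric.mp h3 ((D : K →L[ℂ] K) ξ) ξ
  change _ = (inner ℂ ((D : K →L[ℂ] K) ((D : K →L[ℂ] K) ξ)) ξ).re
  rw [← inner_self_eq_norm_sq (𝕜 := ℂ)]
  exact congrArg Complex.re h4.symm

/-- A bounded increasing sequence in a von Neumann algebra converges strongly to its supremum. -/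
lemma exists_isLUB_of_monotone {u : ℕ → A.toStarSubalgebra} (hu : Monotone u)
    (h0 : ∀ n, 0 ≤ u n) (h1 : ∀ n, u n ≤ 1) :
    ∃ a : A.toStarSubalgebra, IsLUB (Set.range u) a ∧
      ∀ ξ, Tendsto (fun n => (u n : K →L[ℂ] K) ξ) atTop (𝓝 ((a : K →L[ℂ] K) ξ)) := by
  have hsa : ∀ n, IsSelfAdjoint (u n) := fun n => .of_nonneg (h0 n)
  have hcauchy : ∀ ξ, CauchySeq fun n => (u n : K →L[ℂ] K) ξ := by
    intro ξ
    let f : ℕ → ℝ := fun n => (inner ℂ ((u n : K →L[ℂ] K) ξ) ξ).re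
    have hf : Monotone f := fun m n h => re_inner_le (hu h) ξ
    have hb : BddAbove (Set.range f) :=
      ⟨(inner ℂ ((1 : K →L[ℂ] K) ξ) ξ).re, by rintro _ ⟨n, rfl⟩; exact re_inner_le (h1 n) ξ⟩
    have hfc := (tendsto_atTop_ciSup hf hb).cauchySeq
    rw [Metric.cauchySeq_iff'] at hfc ⊢
    intro ε hε
    obtain ⟨N, hN⟩ := hfc (ε ^ 2) (by positivity)
    refine ⟨N, fun n hn => ?_⟩
    -- The increment lies between 0 and 1, so convergence of the quadratic form at ξ gives strong
    -- convergence.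
    have hD := norm_apply_sq_le (sub_nonneg.mpr (hu hn))
      ((sub_le_self _ (h0 N)).trans (h1 n)) ξ
    have h3 := (le_abs_self _).trans_lt (hN n hn)
    have h4 : (inner ℂ (((u n - u N : A.toStarSubalgebra) : K →L[ℂ] K) ξ) ξ).re = f n - f N := by
      change (inner ℂ (((u n : K →L[ℂ] K) - u N) ξ) ξ).re = _
      rw [sub_apply, inner_sub_left, Complex.sub_re]
    rw [dist_eq_norm]
    have h5 : ‖(u n : K →L[ℂ] K) ξ - (u N : K →L[ℂ] K) ξ‖ ^ 2 < ε ^ 2 :=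
      (hD.trans_eq h4).trans_lt h3
    exact lt_of_pow_lt_pow_left₀ 2 hε.le h5
  obtain ⟨a, ha, -, hlim⟩ := exists_strong_limit (R := 1)
    (fun n => (CStarAlgebra.norm_le_one_iff_of_nonneg _ (h0 n)).mpr (h1 n)) hsa hcauchy
  have hre : ∀ ξ, Tendsto (fun n => (inner ℂ ((u n : K →L[ℂ] K) ξ) ξ).re) atTop
      (𝓝 (inner ℂ ((a : K →L[ℂ] K) ξ) ξ).re) := fun ξ =>
    (Complex.continuous_re.tendsto _).comp ((hlim ξ).inner tendsto_const_nhds)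
  refine ⟨a, ⟨?_, ?_⟩, hlim⟩
  · rintro _ ⟨n, rfl⟩
    refine le_of_re_inner_le (hsa n) ha fun ξ => ?_
    exact ge_of_tendsto (hre ξ) ((eventually_ge_atTop n).mono fun m hm => re_inner_le (hu hm) ξ)
  · intro b hb
    have hb' : IsSelfAdjoint b := .of_nonneg ((h0 0).trans (hb ⟨0, rfl⟩))
    refine le_of_re_inner_le ha hb' fun ξ => ?_
    exact le_of_tendsto (hre ξ) (.of_forall fun n => re_inner_le (hb ⟨n, rfl⟩) ξ)

end VonNeumannAlgebra

end VonNeumann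

/-! ### Trace norm completeness of bounded selfadjoint sets. -/

section BallCompleteness

attribute [local instance] VonNeumannAlgebra.cstarAlgebra

open NormedSpace Filter Topology
open scoped ComplexOrder

section Resolvent

variable {B : Type*} [CStarAlgebra B] [PartialOrder B] [StarOrderedRing B]

/-- The element `b (1 + b)⁻¹`, an operator monotone cut-off of `b`. -/
noncomputable def cutoff (b : B) : B := 1 - Ring.inverse (1 + b)

lemma isStrictlyPositive_one_add {b : B} (hb : 0 ≤ b) : IsStrictlyPositive (1 + b) :=
  isStrictlyPositive_one.add_nonneg hb

lemma one_add_mul_inverse {b : B} (hb : 0 ≤ b) : (1 + b) * Ring.inverse (1 + b) = 1 :=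
  Ring.mul_inverse_cancel _ (isStrictlyPositive_one_add hb).isUnit

lemma inverse_mul_one_add {b : B} (hb : 0 ≤ b) : Ring.inverse (1 + b) * (1 + b) = 1 :=
  Ring.inverse_mul_cancel _ (isStrictlyPositive_one_add hb).isUnit

lemma isSelfAdjoint_inverse_one_add {b : B} (hb : 0 ≤ b) :
    IsSelfAdjoint (Ring.inverse (1 + b)) :=
  (isStrictlyPositive_one_add hb).nonneg.isSelfAdjoint.ringInverse

lemma inverse_one_add_nonneg {b : B} (hb : 0 ≤ b) : 0 ≤ Ring.inverse (1 + b) := by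
  have h := (isSelfAdjoint_inverse_one_add hb).conjugate_nonneg
    (isStrictlyPositive_one_add hb).nonneg
  rwa [inverse_mul_one_add hb, one_mul] at h

lemma cutoff_le_one {b : B} (hb : 0 ≤ b) : cutoff b ≤ 1 :=
  sub_le_self _ (inverse_one_add_nonneg hb)

lemma cutoff_mono {b c : B} (hb : 0 ≤ b) (h : b ≤ c) : cutoff b ≤ cutoff c :=
  sub_le_sub_left (CStarAlgebra.ringInverse_le_ringInverse (add_le_add_right h 1)
    (isStrictlyPositive_one_add hb)) 1

lemma cutoff_nonneg {b : B} (hb : 0 ≤ b) : 0 ≤ cutoff b :=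
  sub_nonneg.mpr (by simpa using
    CStarAlgebra.ringInverse_le_ringInverse (le_add_of_nonneg_right hb) isStrictlyPositive_one)

lemma cutoff_le_self {b : B} (hb : 0 ≤ b) : cutoff b ≤ b := by
  have h1 := one_add_mul_inverse hb
  have h2 := inverse_mul_one_add hb
  have h := (IsSelfAdjoint.of_nonneg hb).conjugate_nonneg (inverse_one_add_nonneg hb)
  rw [add_mul, one_mul, add_comm] at h1
  rw [mul_add, mul_one, add_comm] at h2
  have h3 := eq_sub_of_add_eq h1
  have h4 := eq_sub_of_add_eq h2
  rw [h3, sub_mul, one_mul, h4] at h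
  exact sub_nonneg.mp h

/-- With r = (1 + c y²)⁻¹, y k² y ≤ y k y ≤ y r y, and c y r y is the cut-off of c y², which is at
most 1. -/
lemma norm_mul_sq_le_of_le_inverse {y k : B} {c : ℝ} (hc : 0 < c) (hy : IsSelfAdjoint y)
    (hk : 0 ≤ k) (h : k ≤ Ring.inverse (1 + c • (y * y))) : ‖y * k‖ ^ 2 ≤ c⁻¹ := by
  have hyy : 0 ≤ y * y := by simpa [hy.star_eq] using star_mul_self_nonneg y
  have hb : 0 ≤ c • (y * y) := smul_nonneg hc.le hyy
  set r := Ring.inverse (1 + c • (y * y)) with hr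
  have hk1 : k ≤ 1 := h.trans (sub_nonneg.mp (cutoff_nonneg hb))
  have h1 : y * (k * k) * y ≤ y * r * y :=
    hy.conjugate_le_conjugate ((mul_self_le_self_of_le_one hk hk1).trans h)
  have hcomm : Commute y r := by
    have h1 : Commute y (1 + c • (y * y)) :=
      (Commute.one_right y).add_right (((Commute.refl y).mul_right (Commute.refl y)).smul_right c)
    calc y * r = r * (1 + c • (y * y)) * y * r := by rw [inverse_mul_one_add hb, one_mul]
      _ = r * y * ((1 + c • (y * y)) * r) := by rw [mul_assoc r _ y, ← h1.eq]; simp only [mul_assoc]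
      _ = r * y := by rw [one_add_mul_inverse hb, mul_one]
  have h2 : c • (y * r * y) = cutoff (c • (y * y)) := by
    have h3 := one_add_mul_inverse hb
    rw [← hr] at h3
    rw [cutoff, ← hr, mul_assoc, ← hcomm.eq, ← mul_assoc, ← smul_mul_assoc]
    conv_rhs => rw [← h3]
    noncomm_ring
  have h3 : y * r * y ≤ c⁻¹ • (1 : B) := by
    rw [← inv_smul_smul₀ hc.ne' (y * r * y), h2]
    exact smul_le_smul_of_nonneg_left (cutoff_le_one hb) (inv_nonneg.mpr hc.le)
  have h4 : ‖y * k‖ ^ 2 = ‖y * (k * k) * y‖ := by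
    rw [sq, ← CStarRing.norm_self_mul_star, star_mul, hy.star_eq,
      (IsSelfAdjoint.of_nonneg hk).star_eq]
    simp only [mul_assoc]
  have hkk : 0 ≤ k * k := by
    simpa [(IsSelfAdjoint.of_nonneg hk).star_eq] using star_mul_self_nonneg k
  rw [h4]
  rcases subsingleton_or_nontrivial B with hB | hB
  · rw [Subsingleton.elim (y * (k * k) * y) 0, norm_zero]; positivity
  · have := CStarAlgebra.norm_le_norm_of_nonneg_of_le (hy.conjugate_nonneg hkk) (h1.trans h3)
    rwa [norm_smul, norm_one, mul_one, Real.norm_of_nonneg (inv_nonneg.mpr hc.le)] at this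

lemma IsFaithfulTrace.seminorm_sq_le_re {τ : B →ₗ[ℂ] ℂ} (hτ : IsFaithfulTrace τ) {a : B}
    (h0 : 0 ≤ a) (h1 : a ≤ 1) : hτ.seminorm a ^ 2 ≤ (τ a).re := by
  rw [hτ.seminorm_sq, (IsSelfAdjoint.of_nonneg h0).star_eq]
  exact hτ.re_mono (mul_self_le_self_of_le_one h0 h1)

end Resolvent

lemma IsFaithfulTrace.im_eq_zero {B : Type*} [CStarAlgebra B] {τ : B →ₗ[ℂ] ℂ}
    (hτ : IsFaithfulTrace τ) {a : B} (ha : IsSelfAdjoint a) : (τ a).im = 0 := by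
  have h := congrArg Complex.im (hτ.map_star a)
  rw [ha.star_eq] at h
  simp at h
  linarith

variable {K : Type*} [NormedAddCommGroup K] [InnerProductSpace ℂ K] [CompleteSpace K]
  {A : VonNeumannAlgebra K} {τ : A.toStarSubalgebra →ₗ[ℂ] ℂ}

lemma sum_Ico_one_div_four_pow_le (m N : ℕ) :
    ∑ n ∈ Finset.Ico m N, (1 / 4 : ℝ) ^ n ≤ 2 * (1 / 4) ^ m := by
  rcases le_total N m with h | h
  · rw [Finset.Ico_eq_empty_of_le h, Finset.sum_empty]; positivity
  · rw [geom_sum_Ico (by norm_num) h]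
    have h1 : (0 : ℝ) < (1 / 4) ^ m := by positivity
    have h2 : (0 : ℝ) < (1 / 4) ^ N := by positivity
    rw [div_le_iff_of_neg (by norm_num)]
    linarith

namespace IsFiniteNormalFaithfulTrace

lemma isFaithfulTrace (hτ : IsFiniteNormalFaithfulTrace A τ) : IsFaithfulTrace τ :=
  ⟨hτ.nonneg, hτ.trace_comm, hτ.faithful⟩

/-- A non-commutative Egorov theorem: a rapidly vanishing sequence in trace seminorm is
uniformly small after cutting down by elements close to the identity. -/
lemma exists_egorov (hτ : IsFiniteNormalFaithfulTrace A τ) {y : ℕ → A.toStarSubalgebra}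
    (hy : ∀ n, IsSelfAdjoint (y n))
    (hN : ∀ n, hτ.isFaithfulTrace.seminorm (y n) ≤ (1 / 4) ^ n) :
    ∃ a : ℕ → A.toStarSubalgebra, (∀ m, 0 ≤ a m) ∧ (∀ m, a m ≤ 1) ∧
      (∀ m, (τ (a m)).re ≤ 2 * (1 / 4) ^ m) ∧
      (∀ m n, m ≤ n → ‖y n * (1 - a m)‖ ≤ (1 / 2) ^ n) ∧
      ∀ ξ, Tendsto (fun m => ((1 - a m : A.toStarSubalgebra) : K →L[ℂ] K) ξ) atTop (𝓝 ξ) := by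
  let hf := hτ.isFaithfulTrace
  have hyy (n : ℕ) : 0 ≤ y n * y n := by
    simpa [(hy n).star_eq] using star_mul_self_nonneg (y n)
  -- The weight 4^n still leaves traces at most 4^n · 16^{-n} = 4^{-n}, while it forces ‖y n (1 - a
  -- m)‖² ≤ 4^{-n}.
  let t : ℕ → A.toStarSubalgebra := fun n => (4 ^ n : ℝ) • (y n * y n)
  have ht (n : ℕ) : 0 ≤ t n := smul_nonneg (by positivity) (hyy n)
  let b : ℕ → ℕ → A.toStarSubalgebra := fun m N => ∑ n ∈ Finset.Ico m N, t n
  have hb (m N : ℕ) : 0 ≤ b m N := Finset.sum_nonneg fun n _ => ht n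
  have hbm (m : ℕ) : Monotone (b m) := fun N N' h =>
    Finset.sum_le_sum_of_subset_of_nonneg (Finset.Ico_subset_Ico_right h) fun n _ _ => ht n
  have hba (N : ℕ) : Antitone fun m => b m N := fun m m' h =>
    Finset.sum_le_sum_of_subset_of_nonneg (Finset.Ico_subset_Ico_left h) fun n _ _ => ht n
  have hbτ (m N : ℕ) : (τ (b m N)).re ≤ 2 * (1 / 4) ^ m := by
    refine le_trans ?_ (sum_Ico_one_div_four_pow_le m N)
    rw [map_sum, Complex.re_sum]
    refine Finset.sum_le_sum fun n _ => ?_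
    have h1 : (τ (t n)).re = 4 ^ n * hf.seminorm (y n) ^ 2 := by
      rw [IsFaithfulTrace.map_real_smul, Complex.re_ofReal_mul, hf.seminorm_sq, (hy n).star_eq]
    have h2 : hf.seminorm (y n) ^ 2 ≤ ((1 / 4) ^ n) ^ 2 :=
      pow_le_pow_left₀ (apply_nonneg _ _) (hN n) 2
    calc (τ (t n)).re ≤ 4 ^ n * ((1 / 4) ^ n) ^ 2 :=
          h1.trans_le (mul_le_mul_of_nonneg_left h2 (by positivity))
      _ = (1 / 4) ^ n := by rw [sq, ← mul_assoc, ← mul_pow]; norm_num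
  have hLUB (m : ℕ) := VonNeumannAlgebra.exists_isLUB_of_monotone
    (u := fun N => cutoff (b m N)) (fun N N' h => cutoff_mono (hb m N) (hbm m h))
    (fun N => cutoff_nonneg (hb m N)) (fun N => cutoff_le_one (hb m N))
  choose a ha _ using hLUB
  have hle (m N : ℕ) : cutoff (b m N) ≤ a m := (ha m).1 ⟨N, rfl⟩
  have ha0 (m : ℕ) : 0 ≤ a m := (cutoff_nonneg (hb m 0)).trans (hle m 0)
  have ha1 (m : ℕ) : a m ≤ 1 :=
    (ha m).2 (by rintro _ ⟨N, rfl⟩; exact cutoff_le_one (hb m N))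
  have haτ (m : ℕ) : (τ (a m)).re ≤ 2 * (1 / 4) ^ m := by
    -- The cut-offs, unlike the sums b m N, are bounded by 1; their supremum exists and normality
    -- transfers the trace bound to it.
    have h1 := hτ.normal _ _ (Set.range_nonempty _) (directedOn_range.mpr
      (Monotone.directed_le fun N N' h => cutoff_mono (hb m N) (hbm m h)))
      (by rintro _ ⟨N, rfl⟩; exact cutoff_nonneg (hb m N)) (ha m)
    have h2 : τ (a m) ≤ ((2 * (1 / 4) ^ m : ℝ) : ℂ) := by
      refine h1.2 ?_
      rintro _ ⟨_, ⟨N, rfl⟩, rfl⟩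
      rw [Complex.le_def]
      exact ⟨(hf.re_mono (cutoff_le_self (hb m N))).trans (hbτ m N),
        hf.im_eq_zero (.of_nonneg (cutoff_nonneg (hb m N)))⟩
    exact (Complex.le_def.mp h2).1
  have hanti : Antitone a := fun m m' h => (ha m').2 (by
    rintro _ ⟨N, rfl⟩
    exact (cutoff_mono (hb m' N) (hba N h)).trans (hle m N))
  refine ⟨a, ha0, ha1, haτ, fun m n hmn => ?_, ?_⟩
  · have h1 : t n ≤ b m (n + 1) :=
      Finset.single_le_sum (f := t) (fun i _ => ht i) (Finset.mem_Ico.mpr ⟨hmn, n.lt_succ_self⟩)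
    have h2 := (cutoff_mono (ht n) h1).trans (hle m (n + 1))
    have h3 := norm_mul_sq_le_of_le_inverse (c := 4 ^ n) (by positivity) (hy n)
      (sub_nonneg.mpr (ha1 m)) (sub_le_comm.mp h2)
    refine le_of_sq_le_sq (h3.trans_eq ?_) (by positivity)
    rw [← inv_pow, ← pow_mul, mul_comm, pow_mul]; norm_num
  -- The strong limit κ of 1 - a m has τ(1 - κ) ≤ τ(a m) → 0, so faithfulness gives κ = 1.
  · obtain ⟨κ, hκ, hlim⟩ := VonNeumannAlgebra.exists_isLUB_of_monotone
      (u := fun m => 1 - a m) (fun m m' h => sub_le_sub_left (hanti h) 1)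
      (fun m => sub_nonneg.mpr (ha1 m)) (fun m => sub_le_self _ (ha0 m))
    have hκ1 : κ ≤ 1 := hκ.2 (by rintro _ ⟨m, rfl⟩; exact sub_le_self _ (ha0 m))
    have hκ0 : 0 ≤ κ := (sub_nonneg.mpr (ha1 0)).trans (hκ.1 ⟨0, rfl⟩)
    have h1 (m : ℕ) : hf.seminorm (1 - κ) ^ 2 ≤ 2 * (1 / 4) ^ m :=
      ((hf.seminorm_sq_le_re (sub_nonneg.mpr hκ1) (sub_le_self _ hκ0)).trans
        (hf.re_mono (sub_le_comm.mp (hκ.1 ⟨m, rfl⟩)))).trans (haτ m)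
    have h2 : Tendsto (fun m : ℕ => 2 * (1 / 4 : ℝ) ^ m) atTop (𝓝 (2 * 0)) :=
      (tendsto_pow_atTop_nhds_zero_of_lt_one (by norm_num) (by norm_num)).const_mul 2
    have h3 : hf.seminorm (1 - κ) ^ 2 ≤ 0 := by
      simpa using ge_of_tendsto h2 (.of_forall h1)
    have h4 : κ = 1 := by
      refine (sub_eq_zero.mp (hf.eq_zero_of_seminorm_eq_zero ?_)).symm
      exact pow_eq_zero_iff two_ne_zero |>.mp (h3.antisymm (sq_nonneg _))
    intro ξ
    simpa [h4] using hlim ξ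

/-- A rapidly Cauchy subsequence converges in operator norm after cutting down by 1 - a m.
Boundedness and 1 - a m → 1 then give strong convergence, and the strong limit is the trace norm
limit. -/
lemma isBallComplete (hτ : IsFiniteNormalFaithfulTrace A τ) :
    hτ.isFaithfulTrace.IsBallComplete := by
  intro x R hx hR hc
  let hf := hτ.isFaithfulTrace
  have hR0 : 0 ≤ R := (norm_nonneg _).trans (hR 0)
  obtain ⟨φ, hφ, hφN⟩ := extraction_forall_of_eventually'
    (P := fun n k => ∀ i ≥ k, ∀ j ≥ k, hf.seminorm (x i - x j) < (1 / 4) ^ n) (fun n => by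
      obtain ⟨k, hk⟩ := hc ((1 / 4) ^ n) (by positivity)
      exact ⟨k, fun k' hk' i hi j hj => hk i (hk'.trans hi) j (hk'.trans hj)⟩)
  let z : ℕ → A.toStarSubalgebra := fun n => x (φ n)
  obtain ⟨a, ha0, ha1, haτ, hay, hlim⟩ := hτ.exists_egorov
    (y := fun n => z (n + 1) - z n) (fun n => (hx _).sub (hx _))
    (fun n => (hφN n _ (hφ.monotone n.le_succ) _ le_rfl).le)
  have hdiff (m n : ℕ) (hmn : m ≤ n) (l : ℕ) :
      ‖(z (n + l) - z n) * (1 - a m)‖ ≤ 2 * (1 / 2) ^ n - 2 * (1 / 2) ^ (n + l) := by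
    induction l with
    | zero => simp
    | succ l ih =>
      have h1 := hay m (n + l) (by omega)
      have h2 : (z (n + (l + 1)) - z n) * (1 - a m)
          = (z (n + l + 1) - z (n + l)) * (1 - a m) + (z (n + l) - z n) * (1 - a m) := by
        rw [← add_mul, sub_add_sub_cancel, add_assoc]
      rw [h2]
      refine (norm_add_le _ _).trans ((add_le_add h1 ih).trans (le_of_eq ?_))
      rw [← add_assoc, pow_succ]; ring
  have hdiff' (m n i : ℕ) (hmn : m ≤ n) (hni : n ≤ i) :
      ‖(z i - z n) * (1 - a m)‖ ≤ 2 * (1 / 2) ^ n := by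
    obtain ⟨l, rfl⟩ := Nat.exists_eq_add_of_le hni
    exact (hdiff m n hmn l).trans (sub_le_self _ (by positivity))
  have hgeom : Tendsto (fun n : ℕ => (1 / 2 : ℝ) ^ n) atTop (𝓝 0) :=
    tendsto_pow_atTop_nhds_zero_of_lt_one (by norm_num) (by norm_num)
  have hcauchy (ξ : K) : CauchySeq fun n => (z n : K →L[ℂ] K) ξ := by
    rw [Metric.cauchySeq_iff']
    intro ε hε
    have h1 : Tendsto (fun m => 2 * R * ‖ξ - ((1 - a m : A.toStarSubalgebra) : K →L[ℂ] K) ξ‖)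
        atTop (𝓝 (2 * R * ‖ξ - ξ‖)) := ((tendsto_const_nhds.sub (hlim ξ)).norm).const_mul _
    rw [sub_self, norm_zero, mul_zero] at h1
    obtain ⟨m, hm⟩ := (h1.eventually_lt_const (half_pos hε)).exists
    have h2 : Tendsto (fun n : ℕ => 2 * (1 / 2 : ℝ) ^ n * ‖ξ‖) atTop (𝓝 (2 * 0 * ‖ξ‖)) :=
      (hgeom.const_mul 2).mul_const _
    rw [mul_zero, zero_mul] at h2
    obtain ⟨n, hn, hmn⟩ := ((h2.eventually_lt_const (half_pos hε)).and
      (eventually_ge_atTop m)).exists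
    refine ⟨n, fun i hi => ?_⟩
    set k : K →L[ℂ] K := ((1 - a m : A.toStarSubalgebra) : K →L[ℂ] K) with hk
    have h3 : (z i : K →L[ℂ] K) ξ - (z n : K →L[ℂ] K) ξ
        = ((z i : K →L[ℂ] K) - z n) (ξ - k ξ) + (((z i : K →L[ℂ] K) - z n) * k) ξ := by
      change _ = _ + ((z i : K →L[ℂ] K) - z n) (k ξ)
      rw [← map_add, sub_add_cancel, sub_apply]
    have h4 : ‖(z i : K →L[ℂ] K) - z n‖ ≤ 2 * R :=
      (norm_sub_le _ _).trans (by have := hR (φ i); have := hR (φ n); linarith!)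
    have h5 : ‖((z i : K →L[ℂ] K) - z n) * k‖ ≤ 2 * (1 / 2) ^ n := hdiff' m n i hmn hi
    rw [dist_eq_norm, h3]
    calc _ ≤ 2 * R * ‖ξ - k ξ‖ + 2 * (1 / 2) ^ n * ‖ξ‖ :=
          (norm_add_le _ _).trans (add_le_add
            ((ContinuousLinearMap.le_opNorm _ _).trans (by gcongr))
            ((ContinuousLinearMap.le_opNorm _ _).trans (by gcongr)))
      _ < ε := by linarith
  obtain ⟨w, hw, hwR, hwlim⟩ := VonNeumannAlgebra.exists_strong_limit (T := z)
    (fun n => hR (φ n)) (fun n => hx (φ n)) hcauchy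
  refine ⟨w, hw, hwR, ?_⟩
  -- The operator norm is lower semicontinuous under strong limits, so the telescoped bound survives
  -- i → ∞.
  have hwn (n : ℕ) : ‖(w - z n) * (1 - a n)‖ ≤ 2 * (1 / 2) ^ n := by
    refine ContinuousLinearMap.opNorm_le_bound
      (((w - z n) * (1 - a n) : A.toStarSubalgebra) : K →L[ℂ] K) (by positivity) fun ξ => ?_
    let η := ((1 - a n : A.toStarSubalgebra) : K →L[ℂ] K) ξ
    change ‖(w : K →L[ℂ] K) η - (z n : K →L[ℂ] K) η‖ ≤ _
    refine le_of_tendsto ((hwlim η).sub_const _).norm ((eventually_ge_atTop n).mono fun i hi => ?_)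
    exact (((((z i - z n) * (1 - a n) : A.toStarSubalgebra) : K →L[ℂ] K)).le_opNorm ξ).trans
      (mul_le_mul_of_nonneg_right (hdiff' n n i le_rfl hi) (norm_nonneg ξ))
  have hNa (n : ℕ) : hf.seminorm (a n) ≤ 2 * (1 / 2) ^ n := by
    refine le_of_sq_le_sq ((hf.seminorm_sq_le_re (ha0 n) (ha1 n)).trans ((haτ n).trans ?_))
      (by positivity)
    rw [mul_pow, ← pow_mul, mul_comm n, pow_mul]
    norm_num
  have hN (n : ℕ) : hf.seminorm (z n - w)
      ≤ (2 * hf.seminorm 1 + 4 * R) * (1 / 2) ^ n := by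
    -- The first term is small in operator norm; in the second, a n is small in trace norm and w - z
    -- n is bounded.
    have h1 : w - z n = (w - z n) * (1 - a n) + (w - z n) * a n := by noncomm_ring
    have h2 : ‖w - z n‖ ≤ 2 * R :=
      (norm_sub_le _ _).trans (by have : ‖z n‖ ≤ R := hR (φ n); linarith)
    rw [map_sub_rev, h1]
    calc _ ≤ hf.seminorm 1 * (2 * (1 / 2) ^ n) + 2 * R * (2 * (1 / 2) ^ n) :=
          (map_add_le_add _ _ _).trans (add_le_add
            ((hf.seminorm_le_norm _).trans
              (mul_le_mul_of_nonneg_left (hwn n) (apply_nonneg _ _)))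
            ((hf.seminorm_mul_le_left _ _).trans
              (mul_le_mul h2 (hNa n) (apply_nonneg _ _) (by positivity))))
      _ = _ := by ring
  have hsub : Tendsto (fun n => (2 * hf.seminorm 1 + 4 * R) * (1 / 2 : ℝ) ^ n) atTop (𝓝 0) := by
    simpa using hgeom.const_mul (2 * hf.seminorm 1 + 4 * R)
  rw [Metric.tendsto_atTop]
  intro ε hε
  obtain ⟨k, hk⟩ := hc (ε / 2) (half_pos hε)
  obtain ⟨n, hn, hkn⟩ := ((hsub.eventually_lt_const (half_pos hε)).and
    (eventually_ge_atTop k)).exists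
  refine ⟨k, fun i hi => ?_⟩
  rw [Real.dist_0_eq_abs, abs_of_nonneg (apply_nonneg _ _)]
  have h1 := hk i hi (φ n) (hkn.trans (hφ.id_le n))
  calc hf.seminorm (x i - w) = hf.seminorm ((x i - x (φ n)) + (z n - w)) := by
        rw [sub_add_sub_cancel]
    _ ≤ hf.seminorm (x i - x (φ n)) + hf.seminorm (z n - w) := map_add_le_add _ _ _
    _ < ε := by have := hN n; linarith!

end IsFiniteNormalFaithfulTrace

end BallCompleteness

/-! ### The bounded projection and the triple splitting of the selfadjoint part. -/

section Splitting

variable {B : Type*} [CStarAlgebra B]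

/-- Closed algebraic complements in a Banach space are topological complements; precomposing with
the real part extends the projection to all of B. -/
lemma exists_projection_of_isCompl_selfAdjoint {H S : Submodule ℝ B} (hH : IsClosed (H : Set B))
    (hS : IsClosed (S : Set B)) (hinf : H ⊓ S = ⊥) (hsup : H ⊔ S = selfAdjoint.submodule ℝ B) :
    ∃ E : B →L[ℝ] B, ∀ z, IsSelfAdjoint z → E z ∈ H ∧ z - E z ∈ S := by
  let M := selfAdjoint.submodule ℝ B
  have hM : IsClosed (M : Set B) := isClosed_eq continuous_star continuous_id
  have : CompleteSpace M := hM.completeSpace_coe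
  have hc : IsCompl (H.submoduleOf M) (S.submoduleOf M) := by
    constructor
    · rw [Submodule.disjoint_def]
      intro x hx hx'
      have h : (x : B) ∈ H ⊓ S := ⟨hx, hx'⟩
      rw [hinf] at h
      exact Subtype.ext h
    · rw [codisjoint_iff, eq_top_iff]
      rintro ⟨z, hz⟩ -
      have hz' : z ∈ H ⊔ S := hsup ▸ hz
      obtain ⟨x, hx, y, hy, rfl⟩ := Submodule.mem_sup.mp hz'
      refine Submodule.mem_sup.mpr ⟨⟨x, ?_⟩, hx, ⟨y, ?_⟩, hy, rfl⟩
      · exact hsup.le (Submodule.mem_sup_left hx)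
      · exact hsup.le (Submodule.mem_sup_right hy)
  have hT : (H.submoduleOf M).IsTopCompl (S.submoduleOf M) :=
    Submodule.IsCompl.isTopCompl_of_isClosed hc (hH.preimage continuous_subtype_val)
      (hS.preimage continuous_subtype_val)
  let P : B →L[ℝ] M :=
    ((1 / 2 : ℝ) • (ContinuousLinearMap.id ℝ B + (starL' ℝ : B ≃L[ℝ] B))).codRestrict M fun z =>
      (IsSelfAdjoint.all (1 / 2 : ℝ)).smul (IsSelfAdjoint.add_star_self z)
  refine ⟨M.subtypeL ∘L (H.submoduleOf M).subtypeL ∘L (H.submoduleOf M).projectionOntoL _ hT ∘L P,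
    fun z hz => ?_⟩
  have hP : P z = ⟨z, hz⟩ := by
    refine Subtype.ext ?_
    change (1 / 2 : ℝ) • (z + star z) = z
    rw [hz.star_eq, ← two_smul ℝ z, smul_smul]
    norm_num
  let w := (H.submoduleOf M).projectionOntoL _ hT ⟨z, hz⟩
  change (((H.submoduleOf M).projectionOntoL _ hT (P z) : M) : B) ∈ H ∧
    z - (((H.submoduleOf M).projectionOntoL _ hT (P z) : M) : B) ∈ S
  rw [hP]
  refine ⟨w.2, ?_⟩
  have h : (H.submoduleOf M).projectionOntoL _ hT (⟨z, hz⟩ - (w : M)) = 0 := by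
    rw [map_sub, Submodule.projectionOntoL_apply_left]
    exact sub_self w
  exact (Submodule.projectionOntoL_apply_eq_zero_iff hT).mp h

lemma IsFaithfulTrace.eq_zero_of_mul_self {τ : B →ₗ[ℂ] ℂ} (hτ : IsFaithfulTrace τ) {x : B}
    (hx : IsSelfAdjoint x) (h : τ (x * x) = 0) : x = 0 :=
  hτ.faithful x (by rwa [hx.star_eq])

lemma IsSelfAdjoint.lie_lie {q z : B} (hq : IsSelfAdjoint q) (hz : IsSelfAdjoint z) :
    IsSelfAdjoint ⁅q, ⁅q, z⁆⁆ := by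
  simp only [IsSelfAdjoint, Ring.lie_def, star_sub, star_mul, hq.star_eq, hz.star_eq]
  noncomm_ring

/-- ad q is antisymmetric for the trace pairing, so its square is symmetric; hence the double
bracket condition passes from H to its complement. -/
lemma IsFaithfulTrace.map_lie_lie_mul {τ : B →ₗ[ℂ] ℂ} (hτ : IsFaithfulTrace τ) (q z x : B) :
    τ (⁅q, ⁅q, z⁆⁆ * x) = τ (z * ⁅q, ⁅q, x⁆⁆) := by
  have h1 : τ (q * (q * z) * x) = τ (z * (x * q * q)) := by
    rw [hτ.trace_comm z, hτ.trace_comm (q * (q * z))]; simp only [mul_assoc]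
  have h2 : τ (q * (z * q) * x) = τ (z * (q * x * q)) := by
    rw [mul_assoc, hτ.trace_comm]; simp only [mul_assoc]
  have h3 : τ (q * z * q * x) = τ (z * (q * x * q)) := by
    rw [mul_assoc, mul_assoc, hτ.trace_comm]; simp only [mul_assoc]
  simp only [Ring.lie_def, sub_mul, mul_sub, map_sub, h1, h2, h3]
  simp only [mul_assoc]
  ring

lemma IsFaithfulTrace.exists_isTripleSplitting {τ : B →ₗ[ℂ] ℂ} (hτ : IsFaithfulTrace τ)
    {H S : Submodule ℝ B} (hH : IsClosed (H : Set B))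
    (hS : IsClosed (S : Set B)) (hinf : H ⊓ S = ⊥) (hsup : H ⊔ S = selfAdjoint.submodule ℝ B)
    (hlie : ∀ x ∈ H, ∀ y ∈ H, ⁅x, ⁅x, y⁆⁆ ∈ H)
    (hmem : ∀ y, y ∈ S ↔ IsSelfAdjoint y ∧ ∀ x ∈ H, τ (y * x) = 0) :
    ∃ E : B →L[ℝ] B, IsTripleSplitting H S E := by
  obtain ⟨E, hE⟩ := exists_projection_of_isCompl_selfAdjoint hH hS hinf hsup
  have hsa : ∀ x ∈ H, IsSelfAdjoint x := fun x hx => hsup.le (Submodule.mem_sup_left hx)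
  refine ⟨E, hH, hS, hsa, fun x hx => ((hmem x).mp hx).1, fun x hx hx' => ?_,
    fun z hz => (hE z hz).1, fun z hz => (hE z hz).2, hlie, fun q hq z hz => ?_⟩
  · exact hτ.eq_zero_of_mul_self (hsa x hx) (((hmem x).mp hx').2 x hx)
  · refine (hmem _).mpr ⟨(hsa q hq).lie_lie ((hmem z).mp hz).1, fun x hx => ?_⟩
    rw [hτ.map_lie_lie_mul]
    exact ((hmem z).mp hz).2 _ (hlie q hq x hx)

/-- The H-component of such a y is orthogonal to itself, hence zero; so the supplement is the full
orthogonal complement. -/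
lemma IsFaithfulTrace.mem_of_orthogonal {τ : B →ₗ[ℂ] ℂ} (hτ : IsFaithfulTrace τ)
    {H S : Submodule ℝ B} (hsup : H ⊔ S = selfAdjoint.submodule ℝ B)
    (horth : ∀ y ∈ S, ∀ x ∈ H, τ (y * x) = 0) {y : B} (hy : IsSelfAdjoint y)
    (h : ∀ x ∈ H, τ (y * x) = 0) : y ∈ S := by
  have hy' : y ∈ H ⊔ S := hsup ▸ hy
  obtain ⟨x, hx, s, hs, rfl⟩ := Submodule.mem_sup.mp hy'
  have h1 := h x hx
  rw [add_mul, map_add, horth s hs x hx, add_zero] at h1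
  rwa [hτ.eq_zero_of_mul_self (hsup.le (Submodule.mem_sup_left hx)) h1, zero_add]

end Splitting

/-! ### Assembly for von Neumann algebras. -/

section VonNeumannDecomposition

attribute [local instance] VonNeumannAlgebra.cstarAlgebra

variable {K : Type*} [NormedAddCommGroup K] [InnerProductSpace ℂ K] [CompleteSpace K]
  {A : VonNeumannAlgebra K} {τ : A.toStarSubalgebra →ₗ[ℂ] ℂ}

lemma IsFiniteNormalFaithfulTrace.existsUnique_exp_mul_exp_mul_unitary
    (hτ : IsFiniteNormalFaithfulTrace A τ) {H : Submodule ℝ A.toStarSubalgebra}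
    (hH : IsClosed (H : Set A.toStarSubalgebra)) (hsupp : IsTracialSupplemented τ H)
    (hlie : ∀ x ∈ H, ∀ y ∈ H, ⁅x, ⁅x, y⁆⁆ ∈ H) {g : A.toStarSubalgebra} (hg : IsUnit g) :
    ∃! p : A.toStarSubalgebra × A.toStarSubalgebra × unitary A.toStarSubalgebra,
      p.1 ∈ H ∧ p.2.1 ∈ tracialOrthogonal τ H ∧
        g = NormedSpace.exp p.1 * NormedSpace.exp p.2.1 * (p.2.2 : A.toStarSubalgebra) := by
  obtain ⟨S, hS, hle, hinf, hsup⟩ := hsupp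
  have hf := hτ.isFaithfulTrace
  have horth : ∀ y ∈ S, ∀ x ∈ H, τ (y * x) = 0 := fun y hy => (hle hy).2
  have hmem : ∀ y, y ∈ S ↔ IsSelfAdjoint y ∧ ∀ x ∈ H, τ (y * x) = 0 := fun y =>
    ⟨fun hy => hle hy, fun hy => hf.mem_of_orthogonal hsup horth hy.1 hy.2⟩
  obtain ⟨E, hE⟩ := hf.exists_isTripleSplitting hH hS hinf hsup hlie hmem
  obtain ⟨x, hx, y, hy, u, hu, h⟩ :=
    IsTripleSplitting.exists_decomposition hf hE horth hτ.isBallComplete hg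
  refine ⟨(x, y, ⟨u, hu⟩), ⟨hx, hle hy, h⟩, ?_⟩
  rintro ⟨x', y', u'⟩ ⟨hx', hy', h'⟩
  obtain ⟨rfl, rfl, e⟩ := IsTripleSplitting.decomposition_unique hf hE horth hg hx' hx
    ((hmem _).mpr hy') hy u'.2 hu h' h
  exact Prod.ext rfl (Prod.ext rfl (Subtype.ext e))

end VonNeumannDecomposition

theorem mainTheorem6 {K : Type u} [NormedAddCommGroup K] [InnerProductSpace ℂ K] [CompleteSpace K]
    (A : VonNeumannAlgebra K) (τ : A.toStarSubalgebra →ₗ[ℂ] ℂ)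
    (hτ : IsFiniteNormalFaithfulTrace A τ)
    (H : Submodule ℝ A.toStarSubalgebra)
    (hH_selfAdjoint : H ≤ selfAdjoint.submodule ℝ A.toStarSubalgebra)
    (hH_closed : IsClosed (H : Set A.toStarSubalgebra))
    (hH_supplemented : IsTracialSupplemented τ H)
    (hH_bracket : ∀ x ∈ H, ∀ y ∈ H, ⁅x, ⁅x, y⁆⁆ ∈ H)
    (g : A.toStarSubalgebraˣ) :
    ∃! p : A.toStarSubalgebra × A.toStarSubalgebra × unitary A.toStarSubalgebra,
      p.1 ∈ H ∧ p.2.1 ∈ tracialOrthogonal τ H ∧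
        (g : A.toStarSubalgebra) =
          NormedSpace.exp p.1 * NormedSpace.exp p.2.1 * (p.2.2 : A.toStarSubalgebra) :=
  hτ.existsUnique_exp_mul_exp_mul_unitary hH_closed hH_supplemented hH_bracket g.isUnit
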